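/- **Setting.** Let $k>1$, $d\ge 0$ be integers, $\mathsf O\subseteq\mathbb R^d$ (with its Borel $\sigma$-algebra), and let $\mathcal F$ be a convex class of Borel probability measures on $\mathsf O$. Let $\mathsf A=\mathsf A_1\times\dots\times\mathsf A_k\subseteq\mathbb R^k$ be connected and such that $\operatorname{int}(\mathsf A)$ is a nonempty open hyperrectangle (a product of possibly unbounded open intervals). Let $T_i:\mathcal F\to\mathsf A_i$ and $T=(T_1,\dots,T_k)$, with $T(\mathcal F)=\mathsf A$. For a function $g$ such that $g(x,\cdot)$ is measurable and $F$-integrable for all $x$ and all $F\in\mathcal F$ ("$\mathcal F$-integrable") put $\bar g(x,F)=\int_{\mathsf O} g(x,y)\,dF(y)$. An $\mathcal F$-integrable $S:\mathsf A\times\mathsf O\to\mathbb R$ (a scoring function) is strictly $\mathcal F$-consistent for $T$ if for all $x\in\mathsf A$, $F\in\mathcal F$ we have $\bar S(x,F)\ge\bar S(T(F),F)$, with equality only if $x=T(F)$; likewise for $S_i:\mathsf A_i\times\mathsf O\to\mathbb R$ and $T_i$. An $\mathcal F$-integrable $V_i:\mathsf A_i\times\mathsf O\to\mathbb R$ is an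 oriented strict $\mathcal F$-identification function for $T_i$ if for all $x\in\mathsf A_i$, $F\in\mathcal F$: $\bar V_i(x,F)=0\iff x=T_i(F)$ and $\bar V_i(x,F)>0\iff x>T_i(F)$. Write $V(x,y)=(V_1(x_1,y),\dots,V_k(x_k,y))$. Let $S:\mathsf A\times\mathsf O\to\mathbb R$ be a scoring function such that $S(x,\cdot)$ is bounded on compact subsets of $\mathsf O$ for every $x\in\mathsf A$, and consider the following assumptions. * (V1) For every $x\in\operatorname{int}(\mathsf A)$ there are $F_1,\dots,F_{k+1}\in\mathcal F$ with $0\in\operatorname{int}\operatorname{conv}\{\bar V(x,F_1),\dots,\bar V(x,F_{k+1})\}$. * (V4) For every $F\in\mathcal F$, $\bar V(\cdot,F)$ is continuously differentiable on $\operatorname{int}(\mathsf A)$; and for all $r\in\{1,\dots,k\}$ and $t\in\operatorname{int}(\mathsf A)\cap T(\mathcal F)$ there are $F_1,F_2\in\mathcal F$ with $T(F_1)=T(F_2)=t$, $\partial_l\bar V_l(t,F_1)=\partial_l\bar V_l(t,F_2)$ for all $l\ne r$ and $\partial_r\bar V_r(t,F_1)\neq\partial_r\bar V_r(t,F_2)$.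 * (S2) For every $F\in\mathcal F$, $\bar S(\cdot,F)$ is continuous on $\mathsf A$ and continuously differentiable on $\operatorname{int}(\mathsf A)$ with gradient Lipschitz on compact subsets of $\operatorname{int}(\mathsf A)$, and it is twice continuously differentiable at $T(F)$ whenever $T(F)\in\operatorname{int}(\mathsf A)$. * (F1) For every $y\in\mathsf O$ there are $F_n\in\mathcal F$, $n\in\mathbb N$, converging weakly to $\delta_y$, all supported in a common compact set $K\subseteq\mathsf O$. * (VS1) For Lebesgue-almost all $(x,y)\in\mathsf A\times\mathsf O$, $V(x,\cdot)$ and $S(x,\cdot)$ are continuous at $y$. * (B1) $V$ is bounded on every compact subset of $\mathsf A\times\mathsf O$. Assume (F1) and (S2). **Claim.** (a) Let $V_i$ be oriented strict $\mathcal F$-identification functions for $T_i$, $i=1,\dots,k$, such that (V1), (V4), (VS1) and (B1) hold. Then $S$ is strictly $\mathcal F$-consistent for $T$ if and only if there are strictly $\mathcal F$-consistent scoring functions $S_i:\mathsf A_i\times\mathsf O\to\mathbb R$ for $T_i$, $i=1,\dots,k$, such that $$S(x,y)=\sum_{i=1}^k S_i(x_i,y)\quad\text{for Lebesgue-almost all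 }(x,y)\in\mathsf A\times\mathsf O$$ and $\bar S(x,F)=\sum_{i=1}^k\bar S_i(x_i,F)$ for all $x\in\mathsf A$, $F\in\mathcal F$. (b) Whenever $S_i$ is a strictly $\mathcal F$-consistent scoring function for $T_i$, $i=1,\dots,k$, the function $(x,y)\mapsto\sum_{i=1}^k S_i(x_i,y)$ is a strictly $\mathcal F$-consistent scoring function for $T$. (c) This applies to vectors of quantiles and of expectiles: let $j_1,\dots,j_k\in\{1,\dots,d\}$, and for $F\in\mathcal F$ let $F_{j}$ be the distribution function of the $j$-th coordinate under $F$. The equivalence in (a) holds in each of the following cases, provided that (V1), (V4) and (VS1) hold for the stated $V$. Quantiles: $\alpha_i\in(0,1)$; for all $F\in\mathcal F$ and all $i$, $F_{j_i}$ is continuous with unique $\alpha_i$-quantile (i.e. $\inf\{s:F_{j_i}(s)\ge\alpha_i\}=\inf\{s:F_{j_i}(s)>\alpha_i\}$), $T_i(F)$ is this quantile, and $V_i(s,y)=\mathbf 1_{\{y_{j_i}\le s\}}-\alpha_i$. Expectiles: $\tau_i\in(0,1)$; for all $F\in\mathcal F$ and all $i$, the coordinate $y_{j_i}$ is $F$-integrable,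 $T_i(F)$ is its $\tau_i$-expectile, i.e. $\tau_i\int(y_{j_i}-T_i(F))^+dF=(1-\tau_i)\int(T_i(F)-y_{j_i})^+dF$, and $V_i(s,y)=|\mathbf 1_{\{y_{j_i}\le s\}}-\tau_i|\,(s-y_{j_i})$. -/

import Mathlib

open MeasureTheory Set Filter Topology
open scoped NNReal BoundedContinuousFunction

namespace Elicitability

/-! ### Scoring functions and identification functions

`Y` is the observation space, `X` the space containing the action domain `A`, and `𝓕` a class of
Borel probability measures on `Y`. Functions on `A × Y` are total in the first argument; only the
values at points of `A` are used. -/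

section General

variable {X Y : Type*} [MeasurableSpace Y]

/-- The integrated function `ḡ(x, F) = ∫ g(x, y) dF(y)`. -/
noncomputable def mean (g : X → Y → ℝ) (x : X) (F : Measure Y) : ℝ := ∫ y, g x y ∂F

/-- `g : A × Y → ℝ` is `𝓕`-integrable. -/
def ClassIntegrable (𝓕 : Set (Measure Y)) (A : Set X) (g : X → Y → ℝ) : Prop :=
  ∀ x ∈ A, Measurable (g x) ∧ ∀ F ∈ 𝓕, Integrable (g x) F

/-- `S` is a strictly `𝓕`-consistent scoring function for `T : 𝓕 → A`. -/
structure StrictlyConsistent (𝓕 : Set (Measure Y)) (A : Set X) (T : Measure Y → X)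
    (S : X → Y → ℝ) : Prop where
  integrable : ClassIntegrable 𝓕 A S
  consistent : ∀ x ∈ A, ∀ F ∈ 𝓕, mean S (T F) F ≤ mean S x F
  strict : ∀ x ∈ A, ∀ F ∈ 𝓕, mean S x F = mean S (T F) F → x = T F

/-- `V` is an oriented strict `𝓕`-identification function for the real-valued `T : 𝓕 → A`. -/
structure OrientedStrictIdentification (𝓕 : Set (Measure Y)) (A : Set ℝ) (T : Measure Y → ℝ)
    (V : ℝ → Y → ℝ) : Prop where
  integrable : ClassIntegrable 𝓕 A V
  strict : ∀ x ∈ A, ∀ F ∈ 𝓕, mean V x F = 0 ↔ x = T F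
  oriented : ∀ x ∈ A, ∀ F ∈ 𝓕, 0 < mean V x F ↔ T F < x

end General

/-! ### Vectors of functionals, observation domain `O ⊆ ℝᵈ`, action domain `A ⊆ ℝᵏ` -/

section Vector

variable {k d : ℕ} {O : Set (Fin d → ℝ)}

/-- `T(F) = (T₁(F), …, T_k(F))`. -/
def jointFunctional (T : Fin k → Measure O → ℝ) (F : Measure O) : Fin k → ℝ := fun i => T i F

/-- `V̄(x, F)` for `V(x, y) = (V₁(x₁, y), …, V_k(x_k, y))`. -/
noncomputable def meanV (V : Fin k → ℝ → O → ℝ) (x : Fin k → ℝ) (F : Measure O) : Fin k → ℝ :=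
  fun i => mean (V i) (x i) F

/-- The partial derivative `∂_l f (x)`. -/
noncomputable def partialDeriv (f : (Fin k → ℝ) → ℝ) (l : Fin k) (x : Fin k → ℝ) : ℝ :=
  fderiv ℝ f x (Pi.single l 1)

/-- `P(x, y)` holds for almost all `(x, y) ∈ A × O` with respect to `(k + d)`-dimensional
Lebesgue measure. -/
def AlmostAllOn (A : Set (Fin k → ℝ)) (P : (Fin k → ℝ) → O → Prop) : Prop :=
  volume {p : (Fin k → ℝ) × (Fin d → ℝ) | p.1 ∈ A ∧ ∃ h : p.2 ∈ O, ¬ P p.1 ⟨p.2, h⟩} = 0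

/-- A nonempty open hyperrectangle: a product of nonempty, possibly unbounded, open intervals. -/
def IsOpenHyperrectangle (U : Set (Fin k → ℝ)) : Prop :=
  ∃ I : Fin k → Set ℝ,
    (∀ i, IsOpen (I i) ∧ (I i).OrdConnected ∧ (I i).Nonempty) ∧ U = Set.univ.pi I

/-- (V1): for every `x ∈ int A`, `0` is interior to the convex hull of `k + 1` values of
`V̄(x, ·)`. -/
def AssumptionV1 (𝓕 : Set (Measure O)) (A : Set (Fin k → ℝ)) (V : Fin k → ℝ → O → ℝ) : Prop :=
  ∀ x ∈ interior A, ∃ G : Fin (k + 1) → Measure O, (∀ j, G j ∈ 𝓕) ∧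
    (0 : Fin k → ℝ) ∈ interior (convexHull ℝ (Set.range fun j => meanV V x (G j)))

/-- (V3): `V̄(·, F)` is continuously differentiable on `int A`. -/
def AssumptionV3 (𝓕 : Set (Measure O)) (A : Set (Fin k → ℝ)) (V : Fin k → ℝ → O → ℝ) : Prop :=
  ∀ F ∈ 𝓕, ContDiffOn ℝ 1 (fun x => meanV V x F) (interior A)

/-- (V4): (V3) holds, and for all `r` and all attained `t ∈ int A` there are `F₁, F₂` with
`T(F₁) = T(F₂) = t` whose derivatives `∂_l V̄_l(t, ·)` agree for `l ≠ r` and differ for `l = r`. -/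
def AssumptionV4 (𝓕 : Set (Measure O)) (A : Set (Fin k → ℝ)) (T : Fin k → Measure O → ℝ)
    (V : Fin k → ℝ → O → ℝ) : Prop :=
  AssumptionV3 𝓕 A V ∧
  ∀ r : Fin k, ∀ t ∈ interior A ∩ jointFunctional T '' 𝓕,
    ∃ F₁ ∈ 𝓕, ∃ F₂ ∈ 𝓕, jointFunctional T F₁ = t ∧ jointFunctional T F₂ = t ∧
      (∀ l, l ≠ r → partialDeriv (fun x => meanV V x F₁ l) l t
          = partialDeriv (fun x => meanV V x F₂ l) l t) ∧
      partialDeriv (fun x => meanV V x F₁ r) r t ≠ partialDeriv (fun x => meanV V x F₂ r) r t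

/-- (S2): for every `F ∈ 𝓕`, `S̄(·, F)` is continuous on `A` and continuously differentiable on
`int A`, its derivative is Lipschitz on every compact subset of `int A`, and `S̄(·, F)` is twice
continuously differentiable at `T(F)` if `T(F) ∈ int A`. -/
def AssumptionS2 (𝓕 : Set (Measure O)) (A : Set (Fin k → ℝ)) (T : Fin k → Measure O → ℝ)
    (S : (Fin k → ℝ) → O → ℝ) : Prop :=
  ∀ F ∈ 𝓕,
    ContinuousOn (fun x => mean S x F) A ∧
    ContDiffOn ℝ 1 (fun x => mean S x F) (interior A) ∧
    (∀ K : Set (Fin k → ℝ), IsCompact K → K ⊆ interior A →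
      ∃ C : ℝ≥0, LipschitzOnWith C (fderiv ℝ fun x => mean S x F) K) ∧
    (jointFunctional T F ∈ interior A →
      ContDiffAt ℝ 2 (fun x => mean S x F) (jointFunctional T F))

/-- (F1): every Dirac measure `δ_y`, `y ∈ O`, is the weak limit of a sequence in `𝓕` whose members
are supported in a common compact subset of `O`. -/
def AssumptionF1 (𝓕 : Set (Measure O)) : Prop :=
  ∀ y : O, ∃ F : ℕ → Measure O, (∀ n, F n ∈ 𝓕) ∧
    (∀ f : O →ᵇ ℝ, Tendsto (fun n => ∫ z, f z ∂(F n)) atTop (𝓝 (f y))) ∧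
    ∃ K : Set O, IsCompact K ∧ ∀ n, F n Kᶜ = 0

/-- (VS1): for almost all `(x, y) ∈ A × O`, both `V(x, ·)` and `S(x, ·)` are continuous at `y`. -/
def AssumptionVS1 (A : Set (Fin k → ℝ)) (V : Fin k → ℝ → O → ℝ) (S : (Fin k → ℝ) → O → ℝ) :
    Prop :=
  AlmostAllOn A fun x y => (∀ i, ContinuousAt (V i (x i)) y) ∧ ContinuousAt (S x) y

/-- (B1): `V` is bounded on every compact subset of `A × O`. -/
def AssumptionB1 (A : Set (Fin k → ℝ)) (V : Fin k → ℝ → O → ℝ) : Prop :=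
  ∀ K : Set ((Fin k → ℝ) × O), IsCompact K → (∀ p ∈ K, p.1 ∈ A) →
    ∃ M : ℝ, ∀ p ∈ K, ∀ i, |V i (p.1 i) p.2| ≤ M

/-- For every `x ∈ A` the function `S(x, ·)` is bounded on every compact subset of `O`. -/
def ScoreLocallyBounded (A : Set (Fin k → ℝ)) (S : (Fin k → ℝ) → O → ℝ) : Prop :=
  ∀ x ∈ A, ∀ K : Set O, IsCompact K → ∃ M : ℝ, ∀ y ∈ K, |S x y| ≤ M

/-- `S` is separable: there are strictly `𝓕`-consistent scoring functions `S_i : A_i × O → ℝ` for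
`T_i` such that `S(x, y) = ∑ S_i(x_i, y)` for almost all `(x, y) ∈ A × O`, and this identity holds
on the level of expected scores, `S̄(x, F) = ∑ S̄_i(x_i, F)`, for all `x ∈ A` and `F ∈ 𝓕`. -/
def Separable (𝓕 : Set (Measure O)) (Ai : Fin k → Set ℝ) (T : Fin k → Measure O → ℝ)
    (S : (Fin k → ℝ) → O → ℝ) : Prop :=
  ∃ Si : Fin k → ℝ → O → ℝ,
    (∀ i, StrictlyConsistent 𝓕 (Ai i) (T i) (Si i)) ∧
    AlmostAllOn (Set.univ.pi Ai) (fun x y => S x y = ∑ i, Si i (x i) y) ∧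
    ∀ x ∈ Set.univ.pi Ai, ∀ F ∈ 𝓕, mean S x F = ∑ i, mean (Si i) (x i) F

/-! ### Quantiles and expectiles of coordinates -/

/-- The distribution function of the `j`-th coordinate under `F`. -/
noncomputable def coordCDF (F : Measure O) (j : Fin d) (s : ℝ) : ℝ := F.real {y : O | y.1 j ≤ s}

/-- The lower `α`-quantile `inf {s | α ≤ G s}` of a distribution function `G`. -/
noncomputable def lowerQuantile (G : ℝ → ℝ) (α : ℝ) : ℝ := sInf {s : ℝ | α ≤ G s}

/-- The upper `α`-quantile `inf {s | α < G s}` of a distribution function `G`. -/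
noncomputable def upperQuantile (G : ℝ → ℝ) (α : ℝ) : ℝ := sInf {s : ℝ | α < G s}

/-- `e` is the `τ`-expectile of the `j`-th coordinate under `F`:
`τ ∫ (y_j - e)⁺ dF = (1 - τ) ∫ (e - y_j)⁺ dF`, where `y_j` is `F`-integrable. -/
def IsExpectile (F : Measure O) (j : Fin d) (τ e : ℝ) : Prop :=
  Integrable (fun y : O => y.1 j) F ∧
    τ * ∫ y : O, max (y.1 j - e) 0 ∂F = (1 - τ) * ∫ y : O, max (e - y.1 j) 0 ∂F

open Classical in
/-- `V_i(s, y) = 1{y_{j i} ≤ s} - α_i`. -/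
noncomputable def quantileV (j : Fin k → Fin d) (α : Fin k → ℝ) (i : Fin k) (s : ℝ) (y : O) : ℝ :=
  (if y.1 (j i) ≤ s then 1 else 0) - α i

open Classical in
/-- `V_i(s, y) = |1{y_{j i} ≤ s} - τ_i| (s - y_{j i})`. -/
noncomputable def expectileV (j : Fin k → Fin d) (τ : Fin k → ℝ) (i : Fin k) (s : ℝ) (y : O) : ℝ :=
  |(if y.1 (j i) ≤ s then 1 else 0) - τ i| * (s - y.1 (j i))

end Vector

end Elicitability

open Elicitability

/-! The hard direction is that strict consistency forces separability. Fix `x` in the interior of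
`A`. As `F` varies, the pairs (V̄(x,F), ∇S̄(x,F)) form a convex set. If V̄(x,F) = 0 then `x = T(F)`
minimises S̄(·,F), so the gradient vanishes. Since `T` is onto `A`, each coordinate axis is reached
with both signs, and convexity puts the pairs in the graph of a linear map: ∂_i S̄ = ∑_l V̄_l
h_{li}(x), with `h` independent of `F` (`exists_osband_matrix`).

At `t = T(F)` all V̄_l vanish, so the Hessian of S̄(·,F) has entries ∂_j V̄_j · h_{ji}(t). Its
symmetry for two measures that agree in ∂_i V̄_i and differ in ∂_j V̄_j gives h_{ji} = 0 for i ≠ j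
(`osband_matrix_offDiagonal`).

Now ∂_i S̄ = V̄_i(x_i,F) a_i(x), and a_i must be shown to depend on x_i only. Second derivatives are
available only at T(F), so the mixed derivative is controlled by difference quotients and the
Lipschitz gradient, using a measure with T_j(F) = x_j (`hasDerivAt_partialDeriv_mean_zero`,
`osband_coeff_congr`). Integration gives additive separability of S̄(·,F) on the interior, and
continuity extends it to `A` (`mean_score_separable`).

The summands are S with all coordinates but one frozen at a point `z`, up to a multiple of S(z,·).
For generic `z` the identity for expected scores descends to almost every (x,y) by letting measures
tend to δ_y (`exists_generic_point`, `tendsto_integral_of_tendsto_dirac`). The converse is termwise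
minimisation. -/

namespace Elicitability

/-! ### Convex sets with trivial fibre, and convergence to Dirac measures -/

/-- A convex set over `ℝᵏ` whose fibre over `0` is trivial, and which contains points over both
half-axes in every coordinate direction, lies in the graph of a linear map. -/
theorem exists_linear_of_convex {k : ℕ} {E : Type*} [AddCommGroup E] [Module ℝ E]
    {P : Set ((Fin k → ℝ) × E)} (hP : Convex ℝ P) (h0 : ∀ g, ((0 : Fin k → ℝ), g) ∈ P → g = 0)
    (hpos : ∀ j, ∃ c : ℝ, 0 < c ∧ ∃ g, ((Pi.single j c : Fin k → ℝ), g) ∈ P)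
    (hneg : ∀ j, ∃ c : ℝ, c < 0 ∧ ∃ g, ((Pi.single j c : Fin k → ℝ), g) ∈ P) :
    ∃ h : Fin k → E, ∀ p ∈ P, p.2 = ∑ l, p.1 l • h l := by
  -- As `P` is convex, each point of its conic hull is a positive multiple of a point of `P`, so the
  -- fibre over `0` stays trivial in the cone.
  have hC0 : ∀ g, ((0 : Fin k → ℝ), g) ∈ ConvexCone.hull ℝ P → g = 0 := by
    intro g hg
    obtain ⟨c, hc, ⟨v, w⟩, hy, hyg⟩ := (ConvexCone.mem_hull_of_convex hP).1 hg
    simp only at hyg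
    rw [Prod.smul_mk, Prod.mk.injEq] at hyg
    have hv : v = 0 := (smul_eq_zero.1 hyg.1).resolve_left hc.ne'
    subst hv
    rw [← hyg.2, h0 w hy, smul_zero]
  choose cp hcp gp hgp using hpos
  choose cn hcn gn hgn using hneg
  have hsingle : ∀ (j : Fin k) (r : ℝ), r • (Pi.single j (1 : ℝ) : Fin k → ℝ) = Pi.single j r := by
    intro j r
    rw [← Pi.single_smul, smul_eq_mul, mul_one]
  have hp1 : ∀ j, ((Pi.single j (1 : ℝ) : Fin k → ℝ), (cp j)⁻¹ • gp j) ∈ ConvexCone.hull ℝ P := by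
    intro j
    refine (ConvexCone.mem_hull_of_convex hP).2 ⟨(cp j)⁻¹, inv_pos.2 (hcp j), _, hgp j, ?_⟩
    beta_reduce
    rw [Prod.smul_mk, ← Pi.single_smul, smul_eq_mul, inv_mul_cancel₀ (hcp j).ne']
  have hn1 : ∀ j, ((Pi.single j (-1 : ℝ) : Fin k → ℝ), (-cn j)⁻¹ • gn j) ∈ ConvexCone.hull ℝ P := by
    intro j
    refine (ConvexCone.mem_hull_of_convex hP).2 ⟨(-cn j)⁻¹, inv_pos.2 (neg_pos.2 (hcn j)), _, hgn j, ?_⟩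
    beta_reduce
    rw [Prod.smul_mk, ← Pi.single_smul, smul_eq_mul, inv_neg, neg_mul,
      inv_mul_cancel₀ (hcn j).ne]
  -- The two half-axis points add up to a point over `0`, so their second components are opposite.
  have hopp : ∀ j, (-cn j)⁻¹ • gn j = -((cp j)⁻¹ • gp j) := by
    intro j
    have := (ConvexCone.hull ℝ P).add_mem (hn1 j) (hp1 j)
    rw [Prod.mk_add_mk, ← Pi.single_add, neg_add_cancel, Pi.single_zero] at this
    exact eq_neg_of_add_eq_zero_left (hC0 _ this)
  have hline : ∀ (j : Fin k) (r : ℝ), r ≠ 0 →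
      ((Pi.single j r : Fin k → ℝ), r • (cp j)⁻¹ • gp j) ∈ ConvexCone.hull ℝ P := by
    intro j r hr
    rcases hr.lt_or_gt with hr | hr
    · have := (ConvexCone.hull ℝ P).smul_mem (neg_pos.2 hr) (hn1 j)
      rw [hopp, Prod.smul_mk, ← Pi.single_smul, smul_neg, neg_smul, neg_neg] at this
      simpa using this
    · have := (ConvexCone.hull ℝ P).smul_mem hr (hp1 j)
      rwa [Prod.smul_mk, hsingle] at this
  refine ⟨fun j => (cp j)⁻¹ • gp j, fun p hp => ?_⟩
  -- The coordinates of `p` are cancelled one at a time inside the cone; a zero coordinate needs no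
  -- correction. At the end a point over `0` remains.
  have hsum : ∀ s : Finset (Fin k),
      (p.1 - ∑ l ∈ s, Pi.single l (p.1 l), p.2 - ∑ l ∈ s, p.1 l • (cp l)⁻¹ • gp l)
        ∈ ConvexCone.hull ℝ P := by
    intro s
    induction s using Finset.induction_on with
    | empty => simpa using (ConvexCone.mem_hull_of_convex hP).2 ⟨1, one_pos, p, hp, one_smul _ _⟩
    | insert a s ha ih =>
      rcases eq_or_ne (p.1 a) 0 with h | h
      · simpa [Finset.sum_insert ha, h] using ih
      · have := (ConvexCone.hull ℝ P).add_mem ih (hline a (-(p.1 a)) (neg_ne_zero.2 h))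
        rw [Prod.mk_add_mk, Pi.single_neg, neg_smul] at this
        rw [Finset.sum_insert ha, Finset.sum_insert ha]
        convert this using 2 <;> abel
  have := hsum Finset.univ
  rw [Finset.univ_sum_single, sub_self] at this
  exact sub_eq_zero.1 (hC0 _ this)

/-- If `F n → δ_y` weakly with supports in a common set on which `g` is bounded, and `g` is
continuous at `y`, then the integrals of `g` converge to `g y`. -/
theorem tendsto_integral_of_tendsto_dirac {Y : Type*} [PseudoMetricSpace Y] [MeasurableSpace Y]
    [OpensMeasurableSpace Y] {F : ℕ → Measure Y} [∀ n, IsProbabilityMeasure (F n)] {y : Y}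
    (hF : ∀ f : Y →ᵇ ℝ, Tendsto (fun n => ∫ z, f z ∂(F n)) atTop (𝓝 (f y)))
    {K : Set Y} (hK : ∀ n, F n Kᶜ = 0) {g : Y → ℝ} {M : ℝ} (hM : ∀ z ∈ K, |g z| ≤ M)
    (hint : ∀ n, Integrable g (F n)) (hg : ContinuousAt g y) :
    Tendsto (fun n => ∫ z, g z ∂(F n)) atTop (𝓝 (g y)) := by
  rw [Metric.tendsto_atTop]
  intro ε hε
  obtain ⟨δ, hδ, hball⟩ := Metric.continuousAt_iff.1 hg (ε / 2) (half_pos hε)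
  -- `χ` vanishes at `y` and equals 1 off the `δ`-ball, so ε/2 + Bχ dominates |g - g y| on `K`,
  -- while the integral of `χ` tends to 0.
  let χ : Y →ᵇ ℝ := BoundedContinuousFunction.ofNormedAddCommGroup
    (fun z => min 1 (dist z y / δ)) (by fun_prop) 1 (by
      intro z
      rw [Real.norm_of_nonneg (le_min zero_le_one (by positivity))]
      exact min_le_left _ _)
  have hχ : ∀ z, χ z = min 1 (dist z y / δ) := fun z => rfl
  have hχy : χ y = 0 := by rw [hχ]; simp
  set B := |M| + |g y| with hB
  have hB0 : 0 ≤ B := by positivity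
  have hlim := (hF χ).const_mul B
  rw [hχy, mul_zero] at hlim
  obtain ⟨N, hN⟩ := Metric.tendsto_atTop.1 hlim (ε / 2) (half_pos hε)
  refine ⟨N, fun n hn => ?_⟩
  have hχi : Integrable χ (F n) := χ.integrable (F n)
  have hbound : ∀ᵐ z ∂(F n), ‖g z - g y‖ ≤ ε / 2 + B * χ z := by
    filter_upwards [show ∀ᵐ z ∂(F n), z ∈ K from hK n] with z hz
    have hχ0 : 0 ≤ χ z := le_min zero_le_one (by positivity)
    by_cases hd : dist z y < δ
    · have := (hball hd).le
      rw [Real.dist_eq] at this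
      rw [Real.norm_eq_abs]
      nlinarith [mul_nonneg hB0 hχ0]
    · have h1 : χ z = 1 := by
        rw [hχ, min_eq_left]
        rwa [le_div_iff₀ hδ, one_mul, ← not_lt]
      rw [h1, mul_one, Real.norm_eq_abs]
      have := abs_sub (g z) (g y)
      have := hM z hz
      have := le_abs_self M
      linarith
  have hsub : ∫ z, g z ∂(F n) - g y = ∫ z, (g z - g y) ∂(F n) := by
    rw [integral_sub (hint n) (integrable_const _)]; simp
  rw [Real.dist_eq, hsub, ← Real.norm_eq_abs]
  calc ‖∫ z, (g z - g y) ∂(F n)‖ ≤ ∫ z, (ε / 2 + B * χ z) ∂(F n) :=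
        norm_integral_le_of_norm_le ((integrable_const _).add (hχi.const_mul B)) hbound
    _ = ε / 2 + B * ∫ z, χ z ∂(F n) := by
        rw [integral_add (integrable_const _) (hχi.const_mul B), integral_const_mul]; simp
    _ < ε := by
        have := hN n hn
        rw [Real.dist_eq, sub_zero] at this
        have := (abs_lt.1 this).2
        linarith

/-! ### Quantiles -/

section Quantile

variable {k d : ℕ} {O : Set (Fin d → ℝ)}

theorem measurable_coord (j : Fin d) : Measurable fun y : O => y.1 j :=
  (measurable_pi_apply j).comp measurable_subtype_coe

theorem coordCDF_eq_cdf (F : Measure O) [IsProbabilityMeasure F] (j : Fin d) :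
    coordCDF F j = ProbabilityTheory.cdf (F.map fun y : O => y.1 j) := by
  have := Measure.isProbabilityMeasure_map (μ := F) (measurable_coord (O := O) j).aemeasurable
  funext s
  rw [ProbabilityTheory.cdf_eq_real, map_measureReal_apply (measurable_coord j) measurableSet_Iic]
  rfl

/-- Below the lower quantile `G` is less than α by definition of the infimum; above the upper one it
exceeds α by monotonicity. The two coincide, and continuity forces the value α there. -/
theorem quantile_sign {G : ℝ → ℝ} (hG : Continuous G) (hmono : Monotone G)
    (hbot : Tendsto G atBot (𝓝 0)) (htop : Tendsto G atTop (𝓝 1)) {α : ℝ} (hα : α ∈ Ioo (0 : ℝ) 1)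
    (hq : lowerQuantile G α = upperQuantile G α) (s : ℝ) :
    (G s = α ↔ s = lowerQuantile G α) ∧ (α < G s ↔ lowerQuantile G α < s) := by
  -- The tail limits keep the level sets nonempty and bounded below, so `sInf` is a genuine infimum.
  obtain ⟨a, ha⟩ := (hbot.eventually (gt_mem_nhds hα.1)).exists
  obtain ⟨b, hb⟩ := (htop.eventually (lt_mem_nhds hα.2)).exists
  have hbdd : BddBelow {s : ℝ | α ≤ G s} := by
    refine ⟨a, fun x hx => ?_⟩
    by_contra! h
    exact absurd (hmono h.le) (not_le.2 (ha.trans_le hx))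
  have hlt : ∀ x, x < lowerQuantile G α → G x < α := by
    intro x hx
    by_contra! h
    exact absurd (csInf_le hbdd h) (not_le.2 hx)
  have hgt : ∀ x, lowerQuantile G α < x → α < G x := by
    intro x hx
    rw [hq] at hx
    obtain ⟨y, hy, hyx⟩ := exists_lt_of_csInf_lt ⟨b, hb⟩ hx
    exact lt_of_lt_of_le hy (hmono hyx.le)
  have heq : G (lowerQuantile G α) = α := by
    apply le_antisymm
    · exact le_of_tendsto (hG.continuousAt.tendsto.mono_left
        (nhdsWithin_le_nhds (s := Iio (lowerQuantile G α))))
        (eventually_nhdsWithin_of_forall fun x hx => (hlt x hx).le)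
    · exact ge_of_tendsto (hG.continuousAt.tendsto.mono_left
        (nhdsWithin_le_nhds (s := Ioi (lowerQuantile G α))))
        (eventually_nhdsWithin_of_forall fun x hx => (hgt x hx).le)
  rcases lt_trichotomy s (lowerQuantile G α) with h | h | h
  · exact ⟨iff_of_false (hlt s h).ne h.ne, iff_of_false (hlt s h).not_gt h.not_gt⟩
  · subst h
    exact ⟨iff_of_true heq rfl, iff_of_false heq.not_gt (lt_irrefl _)⟩
  · exact ⟨iff_of_false (hgt s h).ne' h.ne', iff_of_true (hgt s h) h⟩

theorem measurable_quantileV (j : Fin k → Fin d) (α : Fin k → ℝ) (i : Fin k) (s : ℝ) :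
    Measurable (quantileV (O := O) j α i s) := by
  unfold quantileV
  exact (Measurable.ite (measurableSet_le (measurable_coord (j i)) measurable_const)
    measurable_const measurable_const).sub_const _

theorem mean_quantileV (j : Fin k → Fin d) (α : Fin k → ℝ) (i : Fin k) (s : ℝ)
    (F : Measure O) [IsProbabilityMeasure F] :
    Integrable (quantileV j α i s) F ∧
      mean (quantileV j α i) s F = coordCDF F (j i) s - α i := by
  classical
  have hm : MeasurableSet {y : O | y.1 (j i) ≤ s} :=
    measurableSet_le (measurable_coord (j i)) measurable_const
  have hV : quantileV (O := O) j α i s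
      = fun y => {y : O | y.1 (j i) ≤ s}.indicator (fun _ => (1 : ℝ)) y - α i := by
    funext y
    simp only [quantileV, indicator, mem_ofPred_eq]
  have hi : Integrable ({y : O | y.1 (j i) ≤ s}.indicator fun _ => (1 : ℝ)) F :=
    (integrable_const _).indicator hm
  refine ⟨hV ▸ hi.sub (integrable_const _), ?_⟩
  rw [mean, hV, integral_sub hi (integrable_const _), integral_indicator_const _ hm]
  simp [coordCDF]

theorem quantileV_identification {𝓕 : Set (Measure O)} (hprob : ∀ F ∈ 𝓕, IsProbabilityMeasure F)
    {T : Fin k → Measure O → ℝ} {j : Fin k → Fin d} {α : Fin k → ℝ} {i : Fin k}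
    (hα : α i ∈ Ioo (0 : ℝ) 1)
    (hT : ∀ F ∈ 𝓕, Continuous (coordCDF F (j i)) ∧
      lowerQuantile (coordCDF F (j i)) (α i) = upperQuantile (coordCDF F (j i)) (α i) ∧
      T i F = lowerQuantile (coordCDF F (j i)) (α i)) (A : Set ℝ) :
    OrientedStrictIdentification 𝓕 A (T i) (quantileV j α i) := by
  have key : ∀ F ∈ 𝓕, ∀ s, (coordCDF F (j i) s = α i ↔ s = T i F) ∧
      (α i < coordCDF F (j i) s ↔ T i F < s) := by
    intro F hF s
    have := hprob F hF
    have := Measure.isProbabilityMeasure_map (μ := F) (measurable_coord (O := O) (j i)).aemeasurable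
    obtain ⟨hc, hq, hTF⟩ := hT F hF
    rw [hTF]
    refine quantile_sign hc ?_ ?_ ?_ hα hq s
    · rw [coordCDF_eq_cdf]; exact ProbabilityTheory.monotone_cdf _
    · rw [coordCDF_eq_cdf]; exact ProbabilityTheory.tendsto_cdf_atBot _
    · rw [coordCDF_eq_cdf]; exact ProbabilityTheory.tendsto_cdf_atTop _
  refine ⟨fun x _ => ⟨measurable_quantileV j α i x, fun F hF => ?_⟩, fun x _ F hF => ?_,
    fun x _ F hF => ?_⟩
  · have := hprob F hF
    exact (mean_quantileV j α i x F).1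
  · have := hprob F hF
    rw [(mean_quantileV j α i x F).2, sub_eq_zero]
    exact (key F hF x).1
  · have := hprob F hF
    rw [(mean_quantileV j α i x F).2, sub_pos]
    exact (key F hF x).2

end Quantile

/-! ### Expectiles -/

section Expectile

variable {k d : ℕ} {O : Set (Fin d → ℝ)}

theorem expectileV_eq (j : Fin k → Fin d) {τ : Fin k → ℝ} {i : Fin k} (hτ : τ i ∈ Ioo (0 : ℝ) 1)
    (s : ℝ) (y : O) :
    expectileV j τ i s y
      = (1 - τ i) * max (s - y.1 (j i)) 0 - τ i * max (y.1 (j i) - s) 0 := by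
  unfold expectileV
  split_ifs with h
  · rw [max_eq_left (sub_nonneg.2 h), max_eq_right (sub_nonpos.2 h),
      abs_of_pos (sub_pos.2 hτ.2)]
    ring
  · have h := (not_le.1 h).le
    rw [max_eq_right (sub_nonpos.2 h), max_eq_left (sub_nonneg.2 h), zero_sub, abs_neg,
      abs_of_pos hτ.1]
    ring

/-- As a function of the forecast, `expectileV` is piecewise linear with slopes τ and 1 - τ. The
bound is uniform in `y`, so it survives integration and makes the mean strictly increasing. -/
theorem expectileV_increment (j : Fin k → Fin d) {τ : Fin k → ℝ} {i : Fin k}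
    (hτ : τ i ∈ Ioo (0 : ℝ) 1) {s t : ℝ} (hst : s ≤ t) (y : O) :
    min (τ i) (1 - τ i) * (t - s) ≤ expectileV j τ i t y - expectileV j τ i s y := by
  rw [expectileV_eq j hτ, expectileV_eq j hτ]
  obtain ⟨h0, h1⟩ := hτ
  have hm1 := min_le_left (τ i) (1 - τ i)
  have hm2 := min_le_right (τ i) (1 - τ i)
  generalize min (τ i) (1 - τ i) = m at *
  generalize y.1 (j i) = z
  generalize τ i = a at *
  rcases le_total z s with hs | hs
  · rw [max_eq_left (by linarith : 0 ≤ t - z), max_eq_right (by linarith : z - t ≤ 0),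
      max_eq_left (by linarith : 0 ≤ s - z), max_eq_right (by linarith : z - s ≤ 0)]
    nlinarith
  · rcases le_total z t with ht | ht
    · rw [max_eq_left (by linarith : 0 ≤ t - z), max_eq_right (by linarith : z - t ≤ 0),
        max_eq_right (by linarith : s - z ≤ 0), max_eq_left (by linarith : 0 ≤ z - s)]
      nlinarith
    · rw [max_eq_right (by linarith : t - z ≤ 0), max_eq_left (by linarith : 0 ≤ z - t),
        max_eq_right (by linarith : s - z ≤ 0), max_eq_left (by linarith : 0 ≤ z - s)]
      nlinarith

theorem expectileV_identification {𝓕 : Set (Measure O)}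
    (hprob : ∀ F ∈ 𝓕, IsProbabilityMeasure F)
    {T : Fin k → Measure O → ℝ} {j : Fin k → Fin d} {τ : Fin k → ℝ} {i : Fin k}
    (hτ : τ i ∈ Ioo (0 : ℝ) 1) (hT : ∀ F ∈ 𝓕, IsExpectile F (j i) (τ i) (T i F)) (A : Set ℝ) :
    OrientedStrictIdentification 𝓕 A (T i) (expectileV j τ i) := by
  have hV : ∀ s, expectileV (O := O) j τ i s = fun y =>
      (1 - τ i) * max (s - y.1 (j i)) 0 - τ i * max (y.1 (j i) - s) 0 :=
    fun s => funext (expectileV_eq j hτ s)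
  have hi1 : ∀ F ∈ 𝓕, ∀ s, Integrable (fun y : O => max (s - y.1 (j i)) 0) F := by
    intro F hF s
    have := hprob F hF
    exact ((integrable_const s).sub (hT F hF).1).pos_part
  have hi2 : ∀ F ∈ 𝓕, ∀ s, Integrable (fun y : O => max (y.1 (j i) - s) 0) F := by
    intro F hF s
    have := hprob F hF
    exact ((hT F hF).1.sub (integrable_const s)).pos_part
  have hint : ∀ F ∈ 𝓕, ∀ s, Integrable (expectileV j τ i s) F := by
    intro F hF s
    rw [hV]
    exact ((hi1 F hF s).const_mul _).sub ((hi2 F hF s).const_mul _)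
  have hzero : ∀ F ∈ 𝓕, mean (expectileV j τ i) (T i F) F = 0 := by
    intro F hF
    rw [mean, hV, integral_sub ((hi1 F hF _).const_mul _) ((hi2 F hF _).const_mul _),
      integral_const_mul, integral_const_mul, (hT F hF).2, sub_self]
  have hmono : ∀ F ∈ 𝓕, StrictMono fun s => mean (expectileV j τ i) s F := by
    intro F hF s t hst
    have := hprob F hF
    have h := integral_mono (μ := F) (integrable_const (min (τ i) (1 - τ i) * (t - s)))
      ((hint F hF t).sub (hint F hF s)) (fun y => expectileV_increment j hτ hst.le y)
    simp only [Pi.sub_apply] at h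
    rw [integral_sub (hint F hF t) (hint F hF s)] at h
    have hpos : 0 < min (τ i) (1 - τ i) * (t - s) :=
      mul_pos (lt_min hτ.1 (sub_pos.2 hτ.2)) (sub_pos.2 hst)
    simp only [integral_const, probReal_univ, one_smul] at h
    simp only [mean]
    linarith
  refine ⟨fun x _ => ⟨?_, fun F hF => hint F hF x⟩, fun x _ F hF => ?_, fun x _ F hF => ?_⟩
  · rw [hV]
    have := measurable_coord (O := O) (j i)
    exact (((measurable_const.sub this).max measurable_const).const_mul _).sub
      (((this.sub_const _).max measurable_const).const_mul _)
  · rw [← hzero F hF]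
    exact (hmono F hF).injective.eq_iff
  · rw [← hzero F hF]
    exact (hmono F hF).lt_iff_lt

end Expectile

/-! ### Osband's principle and its diagonal form -/

section General

variable {X Y : Type*} [MeasurableSpace Y]

theorem mean_add_smul {g : X → Y → ℝ} {x : X} {F G : Measure Y} (hF : Integrable (g x) F)
    (hG : Integrable (g x) G) (a b : ℝ≥0) :
    mean g x (a • F + b • G) = a * mean g x F + b * mean g x G := by
  rw [mean, integral_add_measure (hF.smul_measure_nnreal) (hG.smul_measure_nnreal),
    integral_smul_nnreal_measure, integral_smul_nnreal_measure]
  rfl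

theorem OrientedStrictIdentification.mean_neg {𝓕 : Set (Measure Y)} {A : Set ℝ}
    {T : Measure Y → ℝ} {V : ℝ → Y → ℝ} (hV : OrientedStrictIdentification 𝓕 A T V) {x : ℝ}
    (hx : x ∈ A) {F : Measure Y} (hF : F ∈ 𝓕) (h : x < T F) : mean V x F < 0 := by
  refine lt_of_le_of_ne (not_lt.1 fun h0 => ?_) fun h0 => ?_
  · exact h.not_gt ((hV.oriented x hx F hF).1 h0)
  · exact h.ne ((hV.strict x hx F hF).1 h0)

end General

/-- Because φ vanishes at `x`, the slope of the product is the slope of φ times `c s`.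
Differentiability of `c` is thus not needed, which matters for Osband coefficients known only to be
continuous along a line. -/
theorem hasDerivAt_mul_of_continuousAt {φ c : ℝ → ℝ} {φ' x : ℝ} (hφ : HasDerivAt φ φ' x)
    (h0 : φ x = 0) (hc : ContinuousAt c x) : HasDerivAt (fun s => φ s * c s) (φ' * c x) x := by
  rw [hasDerivAt_iff_tendsto_slope] at hφ ⊢
  refine (hφ.mul (hc.tendsto.mono_left nhdsWithin_le_nhds)).congr fun s => ?_
  simp only [slope_def_field, h0]
  ring

section Vector

variable {k d : ℕ} {O : Set (Fin d → ℝ)} {𝓕 : Set (Measure O)} {Ai : Fin k → Set ℝ}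
  {A : Set (Fin k → ℝ)} {T : Fin k → Measure O → ℝ} {S : (Fin k → ℝ) → O → ℝ}
  {V : Fin k → ℝ → O → ℝ}

theorem add_smul_single_apply_of_ne (x : Fin k → ℝ) {j l : Fin k} (h : l ≠ j) (s : ℝ) :
    (x + s • Pi.single j (1 : ℝ) : Fin k → ℝ) l = x l := by
  simp [Pi.single_eq_of_ne h]

theorem hasDerivAt_add_smul_single (x : Fin k → ℝ) (j : Fin k) (s : ℝ) :
    HasDerivAt (fun r : ℝ => x + r • (Pi.single j (1 : ℝ) : Fin k → ℝ)) (Pi.single j 1) s := by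
  simpa using ((hasDerivAt_id s).smul_const (Pi.single j (1 : ℝ) : Fin k → ℝ)).const_add x

theorem hasDerivAt_partialDeriv {f : (Fin k → ℝ) → ℝ} {x : Fin k → ℝ} {j : Fin k} {s : ℝ}
    (hf : DifferentiableAt ℝ f (x + s • Pi.single j (1 : ℝ))) :
    HasDerivAt (fun r : ℝ => f (x + r • Pi.single j (1 : ℝ)))
      (partialDeriv f j (x + s • Pi.single j (1 : ℝ))) s :=
  hf.hasFDerivAt.comp_hasDerivAt s (hasDerivAt_add_smul_single x j s)

theorem eventually_add_smul_single_mem {U : Set (Fin k → ℝ)} (hU : IsOpen U) {x : Fin k → ℝ}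
    (hx : x ∈ U) (j : Fin k) : ∀ᶠ s : ℝ in 𝓝 0, x + s • (Pi.single j (1 : ℝ) : Fin k → ℝ) ∈ U := by
  have hc := (hasDerivAt_add_smul_single x j 0).continuousAt
  exact hc (hU.mem_nhds (by simpa using hx))

/-- Points x + s e_j near `x` lie in `A`, hence are attained by `T`. Such measures put V̄(x,·) on
the j-th axis with a prescribed sign. -/
theorem exists_functional_gt (hT : jointFunctional T '' 𝓕 = A) {x : Fin k → ℝ}
    (hx : x ∈ interior A) (j : Fin k) :
    ∃ F ∈ 𝓕, x j < T j F ∧ ∀ l, l ≠ j → T l F = x l := by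
  obtain ⟨s, hs, hs0⟩ := (((eventually_add_smul_single_mem isOpen_interior hx j).filter_mono
    (nhdsWithin_le_nhds (s := Ioi 0))).and self_mem_nhdsWithin).exists
  obtain ⟨F, hF, hTF⟩ := hT.symm.subset (interior_subset hs)
  have hTF' : ∀ l, T l F = (x + s • Pi.single j (1 : ℝ) : Fin k → ℝ) l := congrFun hTF
  refine ⟨F, hF, ?_, fun l hl => by rw [hTF', add_smul_single_apply_of_ne x hl]⟩
  rw [hTF']
  simpa using hs0

theorem exists_functional_lt (hT : jointFunctional T '' 𝓕 = A) {x : Fin k → ℝ}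
    (hx : x ∈ interior A) (j : Fin k) :
    ∃ F ∈ 𝓕, T j F < x j ∧ ∀ l, l ≠ j → T l F = x l := by
  obtain ⟨s, hs, hs0⟩ := (((eventually_add_smul_single_mem isOpen_interior hx j).filter_mono
    (nhdsWithin_le_nhds (s := Iio 0))).and self_mem_nhdsWithin).exists
  obtain ⟨F, hF, hTF⟩ := hT.symm.subset (interior_subset hs)
  have hTF' : ∀ l, T l F = (x + s • Pi.single j (1 : ℝ) : Fin k → ℝ) l := congrFun hTF
  refine ⟨F, hF, ?_, fun l hl => by rw [hTF', add_smul_single_apply_of_ne x hl]⟩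
  rw [hTF']
  simpa using hs0

theorem partialDeriv_mean_add_smul (hS : ClassIntegrable 𝓕 A S) {x : Fin k → ℝ}
    (hx : x ∈ interior A) {F G : Measure O} (hF : F ∈ 𝓕) (hG : G ∈ 𝓕)
    (hdF : DifferentiableAt ℝ (fun x => mean S x F) x)
    (hdG : DifferentiableAt ℝ (fun x => mean S x G) x) (a b : ℝ≥0) (i : Fin k) :
    partialDeriv (fun x => mean S x (a • F + b • G)) i x
      = a * partialDeriv (fun x => mean S x F) i x
        + b * partialDeriv (fun x => mean S x G) i x := by
  have heq : (fun x => mean S x (a • F + b • G))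
      =ᶠ[𝓝 x] fun x => (a : ℝ) * mean S x F + b * mean S x G := by
    filter_upwards [isOpen_interior.mem_nhds hx] with y hy
    have := (hS y (interior_subset hy)).2
    exact mean_add_smul (this F hF) (this G hG) a b
  have hsum : HasFDerivAt (fun x => (a : ℝ) * mean S x F + b * mean S x G) _ x :=
    (hdF.hasFDerivAt.const_mul (a : ℝ)).add (hdG.hasFDerivAt.const_mul (b : ℝ))
  rw [partialDeriv, heq.fderiv_eq, hsum.fderiv]
  rfl

/-- Osband's principle: the gradient of the expected score is a linear image of the expected
identification function. -/
theorem exists_osband_matrix (hconv : Convex ℝ≥0 𝓕) (hA : A = Set.univ.pi Ai)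
    (hT : jointFunctional T '' 𝓕 = A)
    (hV : ∀ i, OrientedStrictIdentification 𝓕 (Ai i) (T i) (V i))
    (hS : StrictlyConsistent 𝓕 A (jointFunctional T) S)
    (hd : ∀ F ∈ 𝓕, ∀ x ∈ interior A, DifferentiableAt ℝ (fun x => mean S x F) x)
    {x : Fin k → ℝ} (hx : x ∈ interior A) :
    ∃ h : Fin k → Fin k → ℝ, ∀ F ∈ 𝓕, ∀ i,
      partialDeriv (fun x => mean S x F) i x = ∑ l, mean (V l) (x l) F * h l i := by
  have hxA : ∀ i, x i ∈ Ai i := fun i => (hA ▸ interior_subset hx : x ∈ univ.pi Ai) i (mem_univ i)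
  -- Both components are affine in the measure, so the image of the convex class is convex.
  let Φ : Measure O → (Fin k → ℝ) × (Fin k → ℝ) := fun F =>
    (meanV V x F, fun i => partialDeriv (fun x => mean S x F) i x)
  have hP : Convex ℝ (Φ '' 𝓕) := by
    rintro _ ⟨F, hF, rfl⟩ _ ⟨G, hG, rfl⟩ a b ha hb hab
    lift a to ℝ≥0 using ha
    lift b to ℝ≥0 using hb
    refine ⟨a • F + b • G, hconv hF hG zero_le zero_le (by exact_mod_cast hab), ?_⟩
    refine Prod.ext (funext fun i => ?_) (funext fun i => ?_)
    · have := ((hV i).integrable (x i) (hxA i)).2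
      exact mean_add_smul (this F hF) (this G hG) a b
    · exact partialDeriv_mean_add_smul hS.integrable hx hF hG (hd F hF x hx) (hd G hG x hx) a b i
  have hsingle : ∀ F ∈ 𝓕, ∀ j, (∀ l, l ≠ j → T l F = x l) →
      (Pi.single j (mean (V j) (x j) F), (Φ F).2) ∈ Φ '' 𝓕 := by
    intro F hF j h
    refine ⟨F, hF, Prod.ext (funext fun l => ?_) rfl⟩
    rcases eq_or_ne l j with rfl | hl
    · simp [Φ, meanV]
    · change meanV V x F l = (Pi.single j (mean (V j) (x j) F) : Fin k → ℝ) l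
      rw [Pi.single_eq_of_ne hl]
      exact ((hV l).strict (x l) (hxA l) F hF).2 (h l hl).symm
  suffices ∃ h : Fin k → Fin k → ℝ, ∀ p ∈ Φ '' 𝓕, p.2 = ∑ l, p.1 l • h l by
    obtain ⟨h, hh⟩ := this
    refine ⟨h, fun F hF i => ?_⟩
    have := congrFun (hh _ (mem_image_of_mem Φ hF)) i
    simpa [Φ, meanV] using this
  refine exists_linear_of_convex hP ?_ ?_ ?_
  · rintro g ⟨F, hF, hFg⟩
    rw [Prod.mk.injEq] at hFg
    have hxT : x = jointFunctional T F :=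
      funext fun i => ((hV i).strict (x i) (hxA i) F hF).1 (congrFun hFg.1 i)
    have hmin : IsLocalMin (fun x => mean S x F) x := by
      filter_upwards [isOpen_interior.mem_nhds hx] with y hy
      have := hS.consistent y (interior_subset hy) F hF
      rwa [← hxT] at this
    rw [← hFg.2]
    funext i
    simp [partialDeriv, hmin.fderiv_eq_zero]
  · intro j
    obtain ⟨F, hF, hlt, hne⟩ := exists_functional_lt hT hx j
    exact ⟨_, ((hV j).oriented (x j) (hxA j) F hF).2 hlt, _, hsingle F hF j hne⟩
  · intro j
    obtain ⟨F, hF, hlt, hne⟩ := exists_functional_gt hT hx j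
    exact ⟨_, (hV j).mean_neg (hxA j) hF hlt, _, hsingle F hF j hne⟩

theorem hasDerivAt_mean_identification (hV3 : AssumptionV3 𝓕 A V) {F : Measure O} (hF : F ∈ 𝓕)
    {x : Fin k → ℝ} (hx : x ∈ interior A) (j : Fin k) :
    HasDerivAt (fun s : ℝ => mean (V j) (x j + s) F)
      (partialDeriv (fun x => meanV V x F j) j x) 0 := by
  have hd : DifferentiableAt ℝ (fun x => meanV V x F j) x := by
    have := ((hV3 F hF).differentiableOn one_ne_zero).differentiableAt
      (isOpen_interior.mem_nhds hx)
    exact differentiableAt_pi.1 this j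
  have := hasDerivAt_partialDeriv (f := fun x => meanV V x F j) (x := x) (j := j) (s := 0)
    (by simpa using hd)
  simpa [meanV] using this

/-- Along a line in direction `e_j`, through a point at which `V̄_l(·, F)` vanishes for `l ≠ j`,
only one summand of Osband's principle survives. -/
theorem partialDeriv_add_smul_single (hA : A = Set.univ.pi Ai)
    (hV : ∀ i, OrientedStrictIdentification 𝓕 (Ai i) (T i) (V i))
    {h : (Fin k → ℝ) → Fin k → Fin k → ℝ}
    (hh : ∀ x ∈ interior A, ∀ F ∈ 𝓕, ∀ i,
      partialDeriv (fun x => mean S x F) i x = ∑ l, mean (V l) (x l) F * h x l i)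
    {x : Fin k → ℝ} {j : Fin k} {F : Measure O} (hF : F ∈ 𝓕) (hxF : ∀ l, l ≠ j → T l F = x l)
    {s : ℝ} (hs : x + s • (Pi.single j (1 : ℝ) : Fin k → ℝ) ∈ interior A) (i : Fin k) :
    partialDeriv (fun x => mean S x F) i (x + s • (Pi.single j (1 : ℝ) : Fin k → ℝ))
      = mean (V j) (x j + s) F * h (x + s • (Pi.single j (1 : ℝ) : Fin k → ℝ)) j i := by
  rw [hh _ hs F hF, Finset.sum_eq_single j]
  · simp
  · intro l _ hl
    have hmem : (x + s • (Pi.single j (1 : ℝ) : Fin k → ℝ)) l ∈ Ai l :=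
      (hA ▸ interior_subset hs : _ ∈ univ.pi Ai) l (mem_univ l)
    rw [((hV l).strict _ hmem F hF).2, zero_mul]
    rw [add_smul_single_apply_of_ne x hl, hxF l hl]
  · simp

/-- Along e_j through `t = T(F)` only the term V̄_j h_{ji} survives, and V̄_j vanishes at `t`; its
derivative there is ∂_j V̄_j · h_{ji}(t) once h_{ji} is continuous along the line. -/
theorem fderiv_fderiv_mean_apply (hA : A = Set.univ.pi Ai)
    (hT : jointFunctional T '' 𝓕 = A)
    (hV : ∀ i, OrientedStrictIdentification 𝓕 (Ai i) (T i) (V i)) (hV3 : AssumptionV3 𝓕 A V)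
    (hS2 : AssumptionS2 𝓕 A T S) {h : (Fin k → ℝ) → Fin k → Fin k → ℝ}
    (hh : ∀ x ∈ interior A, ∀ F ∈ 𝓕, ∀ i,
      partialDeriv (fun x => mean S x F) i x = ∑ l, mean (V l) (x l) F * h x l i)
    {F : Measure O} (hF : F ∈ 𝓕) {t : Fin k → ℝ} (ht : t ∈ interior A)
    (hTF : jointFunctional T F = t) (i j : Fin k) :
    fderiv ℝ (fderiv ℝ fun x => mean S x F) t (Pi.single j 1) (Pi.single i 1)
      = partialDeriv (fun x => meanV V x F j) j t * h t j i := by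
  have htA : t j ∈ Ai j := (hA ▸ interior_subset ht : t ∈ univ.pi Ai) j (mem_univ j)
  have hline := eventually_add_smul_single_mem isOpen_interior ht j
  -- Since `h` does not depend on the measure, it is recovered as a quotient of continuous functions
  -- from a `G` with V̄_j(t_j,G) ≠ 0 and the other coordinates of `T(G)` equal to those of `t`.
  have hcont : ContinuousAt (fun s : ℝ => h (t + s • (Pi.single j (1 : ℝ) : Fin k → ℝ)) j i) 0 := by
    obtain ⟨G, hG, hlt, hne⟩ := exists_functional_lt hT ht j
    have hvc := (hasDerivAt_mean_identification hV3 hG ht j).continuousAt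
    have hv0 : mean (V j) (t j + 0) G ≠ 0 := by
      rw [add_zero]
      exact (((hV j).oriented (t j) htA G hG).2 hlt).ne'
    have hpc : ContinuousAt (fun s : ℝ => partialDeriv (fun x => mean S x G) i
        (t + s • (Pi.single j (1 : ℝ) : Fin k → ℝ))) 0 := by
      have h1 : ContinuousAt (fderiv ℝ fun x => mean S x G)
          (t + (0 : ℝ) • (Pi.single j (1 : ℝ) : Fin k → ℝ)) := by
        rw [zero_smul, add_zero]
        exact ((hS2 G hG).2.1.continuousOn_fderiv_of_isOpen isOpen_interior le_rfl).continuousAt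
          (isOpen_interior.mem_nhds ht)
      exact (ContinuousAt.comp (f := fun s : ℝ => t + s • (Pi.single j (1 : ℝ) : Fin k → ℝ)) h1
        (hasDerivAt_add_smul_single t j 0).continuousAt).clm_apply continuousAt_const
    refine (hpc.div hvc hv0).congr ?_
    filter_upwards [hline, hvc.eventually_ne hv0] with s hs hvs
    rw [Pi.div_apply, partialDeriv_add_smul_single hA hV hh hG hne hs i]
    exact mul_div_cancel_left₀ _ hvs
  have hTF' : ∀ l, T l F = t l := congrFun hTF
  have hv := hasDerivAt_mean_identification hV3 hF ht j
  have hd1 := hasDerivAt_mul_of_continuousAt hv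
    (by rw [add_zero]; exact ((hV j).strict (t j) htA F hF).2 (hTF' j).symm) hcont
  have h2 : ContDiffAt ℝ 2 (fun x => mean S x F) t := hTF ▸ (hS2 F hF).2.2.2 (hTF ▸ ht)
  have h3 : DifferentiableAt ℝ (fderiv ℝ fun x => mean S x F) t :=
    (h2.fderiv_right (m := 1) (by norm_num)).differentiableAt one_ne_zero
  have hd2 : HasDerivAt (fun s : ℝ => partialDeriv (fun x => mean S x F) i
      (t + s • (Pi.single j (1 : ℝ) : Fin k → ℝ)))
      (fderiv ℝ (fderiv ℝ fun x => mean S x F) t (Pi.single j 1) (Pi.single i 1)) 0 := by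
    have h4 : HasFDerivAt (fderiv ℝ fun x => mean S x F)
        (fderiv ℝ (fderiv ℝ fun x => mean S x F) t)
        (t + (0 : ℝ) • (Pi.single j (1 : ℝ) : Fin k → ℝ)) := by
      rw [zero_smul, add_zero]
      exact h3.hasFDerivAt
    exact (ContinuousLinearMap.apply ℝ ℝ (Pi.single i (1 : ℝ) : Fin k → ℝ)).hasFDerivAt
      |>.comp_hasDerivAt 0 (h4.comp_hasDerivAt 0 (hasDerivAt_add_smul_single t j 0))
  have hd3 := hd2.congr_of_eventuallyEq (f₁ := fun s : ℝ => mean (V j) (t j + s) F *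
    h (t + s • (Pi.single j (1 : ℝ) : Fin k → ℝ)) j i) (by
      filter_upwards [hline] with s hs
      exact (partialDeriv_add_smul_single hA hV hh hF (fun l _ => hTF' l) hs i).symm)
  have := hd3.unique hd1
  simpa using this

/-- The matrix in Osband's principle is diagonal. -/
theorem osband_matrix_offDiagonal (hA : A = Set.univ.pi Ai)
    (hT : jointFunctional T '' 𝓕 = A)
    (hV : ∀ i, OrientedStrictIdentification 𝓕 (Ai i) (T i) (V i)) (hV4 : AssumptionV4 𝓕 A T V)
    (hS2 : AssumptionS2 𝓕 A T S) {h : (Fin k → ℝ) → Fin k → Fin k → ℝ}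
    (hh : ∀ x ∈ interior A, ∀ F ∈ 𝓕, ∀ i,
      partialDeriv (fun x => mean S x F) i x = ∑ l, mean (V l) (x l) F * h x l i)
    {t : Fin k → ℝ} (ht : t ∈ interior A) {i j : Fin k} (hij : i ≠ j) : h t j i = 0 := by
  obtain ⟨F₁, hF₁, F₂, hF₂, hT₁, hT₂, heq, hne⟩ :=
    hV4.2 j t ⟨ht, hT.symm.subset (interior_subset ht)⟩
  have hsymm : ∀ F ∈ 𝓕, jointFunctional T F = t →
      partialDeriv (fun x => meanV V x F j) j t * h t j i
        = partialDeriv (fun x => meanV V x F i) i t * h t i j := by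
    intro F hF hTF
    rw [← fderiv_fderiv_mean_apply hA hT hV hV4.1 hS2 hh hF ht hTF i j,
      ← fderiv_fderiv_mean_apply hA hT hV hV4.1 hS2 hh hF ht hTF j i]
    have h2 : ContDiffAt ℝ 2 (fun x => mean S x F) t := hTF ▸ (hS2 F hF).2.2.2 (hTF ▸ ht)
    exact (h2.isSymmSndFDerivAt (by simp)) _ _
  -- The right-hand sides of the two symmetry relations agree, while the factors of `h t j i` on the
  -- left differ.
  have h1 := hsymm F₁ hF₁ hT₁
  have h2 := hsymm F₂ hF₂ hT₂
  rw [heq i hij, ← h2] at h1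
  by_contra h0
  exact hne (mul_right_cancel₀ h0 h1)

end Vector

/-! ### Coefficients depending on one coordinate; additive separability -/

section Vector

variable {k d : ℕ} {O : Set (Fin d → ℝ)} {𝓕 : Set (Measure O)} {Ai : Fin k → Set ℝ}
  {A : Set (Fin k → ℝ)} {T : Fin k → Measure O → ℝ} {S : (Fin k → ℝ) → O → ℝ}
  {V : Fin k → ℝ → O → ℝ}

/-- In the diagonal form of Osband's principle, `∂_i S̄(·, F)` has vanishing derivative in
direction `e_j`, `j ≠ i`, at every point whose `j`-th coordinate is `T_j(F)`. -/
theorem hasDerivAt_partialDeriv_mean_zero (hA : A = Set.univ.pi Ai)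
    (hT : jointFunctional T '' 𝓕 = A)
    (hV : ∀ i, OrientedStrictIdentification 𝓕 (Ai i) (T i) (V i)) (hV3 : AssumptionV3 𝓕 A V)
    (hS2 : AssumptionS2 𝓕 A T S) {a : (Fin k → ℝ) → Fin k → ℝ}
    (ha : ∀ x ∈ interior A, ∀ F ∈ 𝓕, ∀ i,
      partialDeriv (fun x => mean S x F) i x = mean (V i) (x i) F * a x i)
    {x : Fin k → ℝ} (hx : x ∈ interior A) {i j : Fin k} (hij : i ≠ j) {F : Measure O}
    (hF : F ∈ 𝓕) (hTF : T j F = x j) :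
    HasDerivAt (fun η : ℝ => partialDeriv (fun x => mean S x F) i
      (x + η • (Pi.single j (1 : ℝ) : Fin k → ℝ))) 0 0 := by
  have hxA : x j ∈ Ai j := (hA ▸ interior_subset hx : x ∈ univ.pi Ai) j (mem_univ j)
  -- `G` is a comparison measure: V̄_j(·,G) is nonzero near x_j, so the Lipschitz bound on ∇S̄(·,G)
  -- controls increments of a_j. The ratio V̄_j(·,F)/V̄_j(·,G) vanishes at x_j.
  obtain ⟨G, hG, hlt, -⟩ := exists_functional_lt hT hx j
  have hG0 : mean (V j) (x j + 0) G ≠ 0 := by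
    rw [add_zero]
    exact (((hV j).oriented (x j) hxA G hG).2 hlt).ne'
  have hF0 : mean (V j) (x j + 0) F = 0 := by
    rw [add_zero]
    exact ((hV j).strict (x j) hxA F hF).2 hTF.symm
  have hGc := (hasDerivAt_mean_identification hV3 hG hx j).continuousAt
  have hFc := (hasDerivAt_mean_identification hV3 hF hx j).continuousAt
  have hρ := hFc.div hGc hG0
  obtain ⟨r, hr, hball⟩ := Metric.nhds_basis_closedBall.mem_iff.1 (isOpen_interior.mem_nhds hx)
  obtain ⟨C, hC⟩ := (hS2 G hG).2.2.1 _ (isCompact_closedBall x r) hball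
  have hd : ∀ y ∈ interior A, DifferentiableAt ℝ (fun x => mean S x F) y := fun y hy =>
    ((hS2 F hF).2.1.differentiableOn one_ne_zero).differentiableAt (isOpen_interior.mem_nhds hy)
  let u : ℝ → ℝ → Fin k → ℝ := fun s η =>
    x + s • (Pi.single i (1 : ℝ) : Fin k → ℝ) + η • (Pi.single j (1 : ℝ) : Fin k → ℝ)
  have hu0 : ∀ η, u 0 η = x + η • (Pi.single j (1 : ℝ) : Fin k → ℝ) := fun η => by simp [u]
  have huj : ∀ s η, u s η j = x j + η := fun s η => by simp [u, Pi.single_eq_of_ne hij.symm]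
  have hnorm : ∀ (l : Fin k) (s : ℝ), ‖s • (Pi.single l (1 : ℝ) : Fin k → ℝ)‖ = |s| := by
    intro l s
    rw [norm_smul, Pi.norm_single, norm_one, mul_one, Real.norm_eq_abs]
  have humem : ∀ s η, |s| ≤ r / 2 → |η| ≤ r / 2 → u s η ∈ Metric.closedBall x r := by
    intro s η hs hη
    rw [mem_closedBall_iff_norm]
    have : u s η - x = s • (Pi.single i (1 : ℝ) : Fin k → ℝ)
        + η • (Pi.single j (1 : ℝ) : Fin k → ℝ) := by simp only [u]; abel
    rw [this]
    refine (norm_add_le _ _).trans ?_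
    rw [hnorm, hnorm]
    linarith
  have hderj : ∀ s η, |s| ≤ r / 2 → |η| ≤ r / 2 → HasDerivAt (fun η => mean S (u s η) F)
      (partialDeriv (fun x => mean S x F) j (u s η)) η := fun s η hs hη =>
    hasDerivAt_partialDeriv (hd _ (hball (humem s η hs hη)))
  have hcomm : ∀ s η, u s η = x + η • (Pi.single j (1 : ℝ) : Fin k → ℝ)
      + s • (Pi.single i (1 : ℝ) : Fin k → ℝ) := fun s η => add_right_comm _ _ _
  have hderi : ∀ s η, |s| ≤ r / 2 → |η| ≤ r / 2 → HasDerivAt (fun s => mean S (u s η) F)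
      (partialDeriv (fun x => mean S x F) i (u s η)) s := by
    intro s η hs hη
    have hmem := hball (humem s η hs hη)
    simp only [hcomm] at hmem ⊢
    exact hasDerivAt_partialDeriv (hd _ hmem)
  rw [hasDerivAt_iff_isLittleO, Asymptotics.isLittleO_iff]
  intro ε hε
  -- `C + 1` replaces `C` so that division is possible when `C = 0`.
  have hC1 : (0 : ℝ) < C + 1 := by positivity
  obtain ⟨δ, hδ, hsmall⟩ := Metric.eventually_nhds_iff_ball.1
    ((hρ.eventually (Metric.ball_mem_nhds _ (div_pos hε hC1))).and (hGc.eventually_ne hG0))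
  have hbound : ∀ s η, |s| ≤ r / 2 → |η| ≤ r / 2 → η ∈ Metric.ball (0 : ℝ) δ →
      ‖partialDeriv (fun x => mean S x F) j (u s η)
        - partialDeriv (fun x => mean S x F) j (u 0 η)‖ ≤ ε * |s| := by
    intro s η hs hη hηδ
    obtain ⟨h1, h2⟩ := hsmall η hηδ
    have h0 : |(0 : ℝ)| ≤ r / 2 := by rw [abs_zero]; linarith
    have hm1 := humem s η hs hη
    have hm2 := humem 0 η h0 hη
    have hlip : ‖partialDeriv (fun x => mean S x G) j (u s η)
        - partialDeriv (fun x => mean S x G) j (u 0 η)‖ ≤ C * |s| := by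
      have h3 := hC.norm_sub_le hm1 hm2
      have h4 : u s η - u 0 η = s • (Pi.single i (1 : ℝ) : Fin k → ℝ) := by
        simp only [u, zero_smul, add_zero]; abel
      rw [h4, hnorm] at h3
      refine le_trans ?_ h3
      have := (fderiv ℝ (fun x => mean S x G) (u s η)
        - fderiv ℝ (fun x => mean S x G) (u 0 η)).le_opNorm (Pi.single j (1 : ℝ))
      simpa [partialDeriv, Pi.norm_single] using this
    rw [ha _ (hball hm1) G hG, ha _ (hball hm2) G hG, huj, huj, ← mul_sub] at hlip
    rw [ha _ (hball hm1) F hF, ha _ (hball hm2) F hF, huj, huj, ← mul_sub]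
    have heq : mean (V j) (x j + η) F * (a (u s η) j - a (u 0 η) j)
        = mean (V j) (x j + η) F / mean (V j) (x j + η) G
          * (mean (V j) (x j + η) G * (a (u s η) j - a (u 0 η) j)) := by
      field_simp
    have h5 : ‖mean (V j) (x j + η) F / mean (V j) (x j + η) G‖ ≤ ε / (C + 1) := by
      rw [dist_eq_norm, Pi.div_apply, Pi.div_apply, hF0, zero_div, sub_zero] at h1
      exact h1.le
    rw [heq, norm_mul]
    calc _ ≤ ε / (C + 1) * (C * |s|) := by gcongr
      _ = ε * |s| * (C / (C + 1)) := by ring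
      _ ≤ ε * |s| * 1 := by gcongr; rw [div_le_one hC1]; linarith
      _ = ε * |s| := mul_one _
  have hδ' : 0 < min δ (r / 2) := lt_min hδ (half_pos hr)
  filter_upwards [Metric.ball_mem_nhds (0 : ℝ) hδ'] with η hη
  have hball' : ∀ η' ∈ Metric.ball (0 : ℝ) (min δ (r / 2)),
      |η'| ≤ r / 2 ∧ η' ∈ Metric.ball (0 : ℝ) δ := by
    intro η' h
    rw [mem_ball_zero_iff, Real.norm_eq_abs, lt_min_iff] at h
    rw [mem_ball_zero_iff, Real.norm_eq_abs]
    exact ⟨h.2.le, h.1⟩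
  have h0 : |(0 : ℝ)| ≤ r / 2 := by rw [abs_zero]; linarith
  have hD := (hderi 0 η h0 (hball' η hη).1).sub (hderi 0 0 h0 h0)
  rw [hu0, hu0] at hD
  rw [smul_zero, sub_zero]
  -- The mixed second difference of S̄(·,F) is at most ε|s||η|, by the mean value inequality in `η`
  -- and `hbound`. Dividing by `s` and letting s → 0 bounds the increment of ∂_i S̄ by ε|η|.
  refine hD.le_of_lip' (by positivity) ?_
  filter_upwards [Metric.ball_mem_nhds (0 : ℝ) (half_pos hr)] with s hs
  rw [mem_ball_zero_iff, Real.norm_eq_abs] at hs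
  have hq := (convex_ball (0 : ℝ) (min δ (r / 2))).norm_image_sub_le_of_norm_hasDerivWithin_le
    (f := fun η => mean S (u s η) F - mean S (u 0 η) F) (C := ε * |s|)
    (fun η' h => ((hderj s η' hs.le (hball' η' h).1).sub
      (hderj 0 η' h0 (hball' η' h).1)).hasDerivWithinAt)
    (fun η' h => hbound s η' hs.le (hball' η' h).1 (hball' η' h).2)
    (Metric.mem_ball_self hδ') hη
  simp only [Pi.sub_apply, sub_zero, Real.norm_eq_abs] at hq ⊢
  calc |mean S (u s η) F - mean S (u s 0) F - (mean S (u 0 η) F - mean S (u 0 0) F)|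
      = |mean S (u s η) F - mean S (u 0 η) F - (mean S (u s 0) F - mean S (u 0 0) F)| := by
        congr 1; ring
    _ ≤ ε * |s| * |η| := hq
    _ = ε * |η| * |s| := by ring

/-- At each point of the line in direction e_j there is a measure with T_j equal to the j-th
coordinate and V̄_i ≠ 0. Since V̄_i is constant along the line, dividing by it gives a_i zero
derivative at that point, so a_i is constant on the segment. -/
theorem osband_coeff_eq_of_update (hA : A = Set.univ.pi Ai)
    (hT : jointFunctional T '' 𝓕 = A) (hAc : Convex ℝ (interior A))
    (hV : ∀ i, OrientedStrictIdentification 𝓕 (Ai i) (T i) (V i)) (hV3 : AssumptionV3 𝓕 A V)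
    (hS2 : AssumptionS2 𝓕 A T S) {a : (Fin k → ℝ) → Fin k → ℝ}
    (ha : ∀ x ∈ interior A, ∀ F ∈ 𝓕, ∀ i,
      partialDeriv (fun x => mean S x F) i x = mean (V i) (x i) F * a x i)
    {x : Fin k → ℝ} (hx : x ∈ interior A) {i j : Fin k} (hij : i ≠ j) {r : ℝ}
    (hr : Function.update x j r ∈ interior A) : a (Function.update x j r) i = a x i := by
  let γ : ℝ → Fin k → ℝ := fun η => x + η • (Pi.single j (1 : ℝ) : Fin k → ℝ)
  have hγ : Continuous γ := by fun_prop
  have hJo : IsOpen (γ ⁻¹' interior A) := isOpen_interior.preimage hγ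
  have hJc : Convex ℝ (γ ⁻¹' interior A) := by
    intro s hs t ht p q hp hq hpq
    have := hAc hs ht hp hq hpq
    have h1 : γ (p • s + q • t) = p • γ s + q • γ t := by
      obtain rfl : q = 1 - p := by linarith
      simp only [γ, smul_eq_mul]
      module
    rwa [mem_preimage, h1]
  have hder : ∀ η ∈ γ ⁻¹' interior A, HasDerivAt (fun η => a (γ η) i) 0 η := by
    intro η hη
    have hγA : γ η i ∈ Ai i := (hA ▸ interior_subset hη : γ η ∈ univ.pi Ai) i (mem_univ i)
    obtain ⟨F, hF, hlt, hne⟩ := exists_functional_lt hT hη i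
    have hv := (((hV i).oriented _ hγA F hF).2 hlt).ne'
    have h1 := (hasDerivAt_partialDeriv_mean_zero hA hT hV hV3 hS2 ha hη hij hF
      (hne j hij.symm)).div_const (mean (V i) (γ η i) F)
    rw [zero_div] at h1
    have h2 : HasDerivAt (fun s : ℝ => a (γ η + s • (Pi.single j (1 : ℝ) : Fin k → ℝ)) i) 0 0 := by
      refine h1.congr_of_eventuallyEq ?_
      filter_upwards [eventually_add_smul_single_mem isOpen_interior hη j] with s hs
      rw [ha _ hs F hF, add_smul_single_apply_of_ne _ hij]
      exact (mul_div_cancel_left₀ _ hv).symm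
    have h3 : HasDerivAt (fun s : ℝ => a (γ η + s • (Pi.single j (1 : ℝ) : Fin k → ℝ)) i) 0
        (η - η) := by rwa [sub_self]
    have h4 := h3.comp_sub_const η η
    refine h4.congr_of_eventuallyEq (Eventually.of_forall fun s => ?_)
    simp only [γ]
    congr 1
    module
  have hupd : γ (r - x j) = Function.update x j r := by
    funext l
    rcases eq_or_ne l j with rfl | hl
    · simp [γ]
    · simp [γ, Pi.single_eq_of_ne hl, Function.update_of_ne hl]
  have hγ0 : γ 0 = x := by simp [γ]
  have := hJo.is_const_of_deriv_eq_zero hJc.isPreconnected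
    (fun η hη => (hder η hη).differentiableAt.differentiableWithinAt)
    (fun η hη => (hder η hη).deriv) (x := r - x j) (y := 0)
    (by rwa [mem_preimage, hupd]) (by rwa [mem_preimage, hγ0])
  simpa only [hupd, hγ0] using this

/-- The `i`-th diagonal coefficient in Osband's principle depends on the `i`-th coordinate only. -/
theorem osband_coeff_congr (hA : A = Set.univ.pi Ai)
    (hT : jointFunctional T '' 𝓕 = A) (hAc : Convex ℝ (interior A)) {I : Fin k → Set ℝ}
    (hI : interior A = univ.pi I)
    (hV : ∀ i, OrientedStrictIdentification 𝓕 (Ai i) (T i) (V i)) (hV3 : AssumptionV3 𝓕 A V)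
    (hS2 : AssumptionS2 𝓕 A T S) {a : (Fin k → ℝ) → Fin k → ℝ}
    (ha : ∀ x ∈ interior A, ∀ F ∈ 𝓕, ∀ i,
      partialDeriv (fun x => mean S x F) i x = mean (V i) (x i) F * a x i)
    {x y : Fin k → ℝ} (hx : x ∈ interior A) (hy : y ∈ interior A) {i : Fin k} (hxy : x i = y i) :
    a x i = a y i := by
  have hmem : ∀ s : Finset (Fin k), s.piecewise x y ∈ interior A := by
    intro s
    rw [hI] at hx hy ⊢
    intro l _
    by_cases hl : l ∈ s
    · simpa [hl] using hx l (mem_univ l)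
    · simpa [hl] using hy l (mem_univ l)
  -- Coordinates are exchanged one by one, which stays inside the box; exchanging the i-th changes
  -- nothing as `x i = y i`.
  have key : ∀ s : Finset (Fin k), a (s.piecewise x y) i = a y i := by
    intro s
    induction s using Finset.induction_on with
    | empty => simp
    | insert j s hj ih =>
      rw [← ih, Finset.piecewise_insert]
      rcases eq_or_ne i j with rfl | hij
      · rw [Function.update_eq_self_iff.2]
        simp [hj, hxy]
      · refine osband_coeff_eq_of_update hA hT hAc hV hV3 hS2 ha (hmem s) hij ?_
        rw [← Finset.piecewise_insert]
        exact hmem _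
  simpa using key Finset.univ

/-- A function on an open convex box each of whose partial derivatives `∂_i f` depends on the
`i`-th coordinate only is additively separable. -/
theorem sub_sum_update_eq_of_partialDeriv {f : (Fin k → ℝ) → ℝ} {U : Set (Fin k → ℝ)}
    (hU : IsOpen U) (hUc : Convex ℝ U) (hf : ∀ x ∈ U, DifferentiableAt ℝ f x) {z : Fin k → ℝ}
    (hz : z ∈ U) (hupd : ∀ x ∈ U, ∀ i, Function.update z i (x i) ∈ U)
    (hp : ∀ x ∈ U, ∀ i, partialDeriv f i x = partialDeriv f i (Function.update z i (x i)))
    {x : Fin k → ℝ} (hx : x ∈ U) :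
    f x - ∑ i, f (Function.update z i (x i)) = f z - ∑ _i : Fin k, f z := by
  have hder : ∀ x ∈ U, HasFDerivAt (fun x => f x - ∑ i, f (Function.update z i (x i)))
      (0 : (Fin k → ℝ) →L[ℝ] ℝ) x := by
    intro x hx
    have h1 : ∀ i, HasFDerivAt (fun x : Fin k → ℝ => f (Function.update z i (x i)))
        ((fderiv ℝ f (Function.update z i (x i))).comp
          ((ContinuousLinearMap.pi (Pi.single i (ContinuousLinearMap.id ℝ ℝ))).comp
            (ContinuousLinearMap.proj (R := ℝ) (φ := fun _ : Fin k => ℝ) i))) x := by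
      intro i
      have h0 : HasFDerivAt (fun x : Fin k → ℝ => x i)
          (ContinuousLinearMap.proj (R := ℝ) (φ := fun _ : Fin k => ℝ) i) x :=
        hasFDerivAt_apply i x
      exact HasFDerivAt.comp (f := fun x : Fin k → ℝ => Function.update z i (x i)) x
        (hf _ (hupd x hx i)).hasFDerivAt
        (HasFDerivAt.comp (g := Function.update z i) x (hasFDerivAt_update z (x i)) h0)
    have h2 := (hf x hx).hasFDerivAt.sub (HasFDerivAt.fun_sum (u := Finset.univ) fun i _ => h1 i)
    refine h2.congr_fderiv ?_
    -- In direction e_m only the m-th summand varies, and `hp` makes it cancel ∂_m f.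
    have hcoord : ∀ m, (fderiv ℝ f x - ∑ i, (fderiv ℝ f (Function.update z i (x i))).comp
          ((ContinuousLinearMap.pi (Pi.single i (ContinuousLinearMap.id ℝ ℝ))).comp
            (ContinuousLinearMap.proj (R := ℝ) (φ := fun _ : Fin k => ℝ) i)))
            (Pi.single m (1 : ℝ)) = 0 := by
      intro m
      have hs : ∀ (i : Fin k) (c : ℝ),
          (ContinuousLinearMap.pi (Pi.single i (ContinuousLinearMap.id ℝ ℝ)) :
            ℝ →L[ℝ] (Fin k → ℝ)) c = Pi.single i c := by
        intro i c
        funext l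
        rcases eq_or_ne l i with rfl | hl
        · simp
        · simp [Pi.single_eq_of_ne hl]
      rw [sub_apply, sum_apply, Finset.sum_eq_single m]
      · simp only [ContinuousLinearMap.comp_apply, ContinuousLinearMap.proj_apply, hs,
          Pi.single_eq_same]
        exact sub_eq_zero.2 (hp x hx m)
      · intro i _ hi
        simp only [ContinuousLinearMap.comp_apply, ContinuousLinearMap.proj_apply, hs,
          Pi.single_eq_of_ne hi, Pi.single_zero, map_zero]
      · simp
    refine ContinuousLinearMap.coe_injective (LinearMap.pi_ext' fun m => ?_)
    ext
    exact hcoord m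
  have := hU.is_const_of_fderiv_eq_zero hUc.isPreconnected
    (fun x hx => (hder x hx).differentiableAt.differentiableWithinAt)
    (fun x hx => (hder x hx).fderiv) hx hz
  simpa using this

end Vector

/-! ### Generic base points -/

/-- For a null set `N` in `ℝᵏ × ℝᵈ`, almost every `z` is such that `N` misses, almost everywhere,
the section at `z` and the sections along all coordinate lines through `z`. -/
theorem exists_generic_point {k d : ℕ} {U : Set (Fin k → ℝ)} (hU : IsOpen U) (hne : U.Nonempty)
    {N : Set ((Fin k → ℝ) × (Fin d → ℝ))} (hN : volume N = 0) :
    ∃ z ∈ U, ∀ᵐ p : (Fin k → ℝ) × (Fin d → ℝ),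
      (z, p.2) ∉ N ∧ ∀ i, (Function.update z i (p.1 i), p.2) ∉ N := by
  have hM : volume (toMeasurable volume N) = 0 := by rw [measure_toMeasurable, hN]
  -- Preimages of null sets under surjective linear maps are null, and Fubini yields almost every
  -- section. The measurable hull stands in for `N`, which need not be measurable.
  have key : ∀ L : ((Fin k → ℝ) × ((Fin k → ℝ) × (Fin d → ℝ))) →ₗ[ℝ]
      ((Fin k → ℝ) × (Fin d → ℝ)), Function.Surjective L →
      ∀ᵐ z : Fin k → ℝ, ∀ᵐ p : (Fin k → ℝ) × (Fin d → ℝ), L (z, p) ∉ N := by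
    intro L hL
    have hD : (volume : Measure ((Fin k → ℝ) × (Fin d → ℝ))).IsAddHaarMeasure :=
      Measure.prod.instIsAddHaarMeasure _ _
    have hE : (volume : Measure ((Fin k → ℝ) × ((Fin k → ℝ) × (Fin d → ℝ)))).IsAddHaarMeasure :=
      Measure.prod.instIsAddHaarMeasure _ _
    have h1 : ∀ᵐ q : (Fin k → ℝ) × ((Fin k → ℝ) × (Fin d → ℝ)),
        L q ∈ (toMeasurable volume N)ᶜ :=
      (ae_comp_linearMap_mem_iff L volume volume hL (measurableSet_toMeasurable _ _).compl).2
        (compl_mem_ae_iff.2 hM)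
    have h2 := Measure.ae_ae_of_ae_prod h1
    filter_upwards [h2] with z hz
    filter_upwards [hz] with p hp hpN
    exact hp (subset_toMeasurable _ _ hpN)
  let L₀ : ((Fin k → ℝ) × ((Fin k → ℝ) × (Fin d → ℝ))) →ₗ[ℝ] ((Fin k → ℝ) × (Fin d → ℝ)) :=
    { toFun := fun q => (q.1, q.2.2)
      map_add' := fun _ _ => rfl
      map_smul' := fun _ _ => rfl }
  let L : Fin k → ((Fin k → ℝ) × ((Fin k → ℝ) × (Fin d → ℝ))) →ₗ[ℝ]
      ((Fin k → ℝ) × (Fin d → ℝ)) := fun i =>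
    { toFun := fun q => (Function.update q.1 i (q.2.1 i), q.2.2)
      map_add' := fun p q => by simp [Function.update_add]
      map_smul' := fun c q => Prod.ext (Function.update_smul c q.1 i (q.2.1 i)) rfl }
  have h₀ := key L₀ fun w => ⟨(w.1, (0, w.2)), rfl⟩
  have h₁ := ae_all_iff.2 fun i => key (L i) fun w =>
    ⟨(w.1, (w.1, w.2)), Prod.ext (Function.update_eq_self i w.1) rfl⟩
  obtain ⟨z, hz, hz0, hz1⟩ :=
    ((frequently_ae_mem_iff.2 (hU.measure_pos volume hne).ne').and_eventually (h₀.and h₁)).exists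
  exact ⟨z, hz, hz0.and (ae_all_iff.2 hz1)⟩

/-! ### Separable scores and strict consistency -/

section Vector

variable {k d : ℕ} {O : Set (Fin d → ℝ)} {𝓕 : Set (Measure O)} {Ai : Fin k → Set ℝ}
  {A : Set (Fin k → ℝ)} {T : Fin k → Measure O → ℝ} {S : (Fin k → ℝ) → O → ℝ}
  {V : Fin k → ℝ → O → ℝ}

/-- The expected score is an additively separable function of the forecast. -/
theorem mean_score_separable (hconv : Convex ℝ≥0 𝓕) (hA : A = Set.univ.pi Ai)
    (hAc : Convex ℝ A) (hArect : IsOpenHyperrectangle (interior A))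
    (hT : jointFunctional T '' 𝓕 = A)
    (hV : ∀ i, OrientedStrictIdentification 𝓕 (Ai i) (T i) (V i)) (hV4 : AssumptionV4 𝓕 A T V)
    (hS2 : AssumptionS2 𝓕 A T S) (hS : StrictlyConsistent 𝓕 A (jointFunctional T) S)
    {F : Measure O} (hF : F ∈ 𝓕) {z : Fin k → ℝ} (hz : z ∈ interior A) {x : Fin k → ℝ}
    (hx : x ∈ A) :
    mean S x F - ∑ i, mean S (Function.update z i (x i)) F
      = mean S z F - ∑ _i : Fin k, mean S z F := by
  obtain ⟨I, -, hI⟩ := hArect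
  have hd : ∀ F ∈ 𝓕, ∀ x ∈ interior A, DifferentiableAt ℝ (fun x => mean S x F) x :=
    fun F hF x hx => ((hS2 F hF).2.1.differentiableOn one_ne_zero).differentiableAt
      (isOpen_interior.mem_nhds hx)
  have hosband : ∀ x : Fin k → ℝ, ∃ h : Fin k → Fin k → ℝ, x ∈ interior A → ∀ F ∈ 𝓕, ∀ i,
      partialDeriv (fun x => mean S x F) i x = ∑ l, mean (V l) (x l) F * h l i := by
    intro x
    by_cases hx : x ∈ interior A
    · obtain ⟨h, hh⟩ := exists_osband_matrix hconv hA hT hV hS hd hx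
      exact ⟨h, fun _ => hh⟩
    · exact ⟨0, fun h => absurd h hx⟩
  choose h hh using hosband
  have ha : ∀ x ∈ interior A, ∀ F ∈ 𝓕, ∀ i,
      partialDeriv (fun x => mean S x F) i x = mean (V i) (x i) F * h x i i := by
    intro x hx F hF i
    rw [hh x hx F hF i, Finset.sum_eq_single i]
    · intro l _ hl
      rw [osband_matrix_offDiagonal hA hT hV hV4 hS2 hh hx hl.symm, mul_zero]
    · simp
  have hupd : ∀ x ∈ interior A, ∀ i, Function.update z i (x i) ∈ interior A := by
    intro x hx i
    rw [hI] at hx hz ⊢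
    intro l _
    rcases eq_or_ne l i with rfl | hl
    · simpa using hx l (mem_univ l)
    · simpa [Function.update_of_ne hl] using hz l (mem_univ l)
  have hupdA : ∀ x ∈ A, ∀ i, Function.update z i (x i) ∈ A := by
    intro x hx i
    have hz' := interior_subset hz
    rw [hA] at hx hz' ⊢
    intro l _
    rcases eq_or_ne l i with rfl | hl
    · simpa using hx l (mem_univ l)
    · simpa [Function.update_of_ne hl] using hz' l (mem_univ l)
  have hinterior : EqOn (fun x => mean S x F - ∑ i, mean S (Function.update z i (x i)) F)
      (fun _ => mean S z F - ∑ _i : Fin k, mean S z F) (interior A) := by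
    intro x hx
    refine sub_sum_update_eq_of_partialDeriv (f := fun x => mean S x F) isOpen_interior
      hAc.interior (hd F hF) hz hupd (fun x hx i => ?_) hx
    rw [ha x hx F hF, ha _ (hupd x hx i) F hF, Function.update_self,
      osband_coeff_congr (a := fun x i => h x i i) hA hT hAc.interior hI hV hV4.1 hS2 ha hx
        (hupd x hx i) (by simp)]
  have hcont : ContinuousOn (fun x => mean S x F - ∑ i, mean S (Function.update z i (x i)) F) A := by
    refine (hS2 F hF).1.sub (continuousOn_finsetSum _ fun i _ => ?_)
    refine (hS2 F hF).1.comp (f := fun x : Fin k → ℝ => Function.update z i (x i))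
      (Continuous.continuousOn ?_) (fun x hx => hupdA x hx i)
    exact continuous_const.update i (continuous_apply i)
  -- A convex set with nonempty interior lies in the closure of that interior, so continuity carries
  -- the identity to all of `A`.
  refine hinterior.of_subset_closure hcont continuousOn_const interior_subset ?_ hx
  rw [hAc.closure_interior_eq_closure_of_nonempty_interior ⟨z, hz⟩]
  exact subset_closure

/-- Each factor is a coordinate projection of a connected set, hence an interval. -/
theorem convex_of_isConnected_pi (hA : A = Set.univ.pi Ai) (hAconn : IsConnected A) :
    Convex ℝ A := by
  rw [hA]
  refine convex_pi fun i _ => ?_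
  have himg : (fun x : Fin k → ℝ => x i) '' A = Ai i := by
    rw [hA]
    exact eval_image_univ_pi (hA ▸ hAconn.nonempty)
  rw [← himg]
  exact (hAconn.isPreconnected.image _ (continuous_apply i).continuousOn).ordConnected.convex

theorem separable_of_strictlyConsistent (hk : 1 < k) (hprob : ∀ F ∈ 𝓕, IsProbabilityMeasure F)
    (hconv : Convex ℝ≥0 𝓕) (hA : A = Set.univ.pi Ai) (hAconn : IsConnected A)
    (hArect : IsOpenHyperrectangle (interior A)) (hT : jointFunctional T '' 𝓕 = A)
    (hF1 : AssumptionF1 𝓕) (hS2 : AssumptionS2 𝓕 A T S) (hSbdd : ScoreLocallyBounded A S)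
    (hV : ∀ i, OrientedStrictIdentification 𝓕 (Ai i) (T i) (V i)) (hV4 : AssumptionV4 𝓕 A T V)
    (hVS1 : AssumptionVS1 A V S) (hS : StrictlyConsistent 𝓕 A (jointFunctional T) S) :
    Separable 𝓕 Ai T S := by
  have hne : (interior A).Nonempty := by
    obtain ⟨I, hI, hIA⟩ := hArect
    rw [hIA]
    exact univ_pi_nonempty_iff.2 fun i => (hI i).2.2
  obtain ⟨z, hz, hgen⟩ := exists_generic_point isOpen_interior hne hVS1
  have hzA := interior_subset hz
  have hAc := convex_of_isConnected_pi hA hAconn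
  have hupd : ∀ i, ∀ s ∈ Ai i, Function.update z i s ∈ A := by
    intro i s hs
    rw [hA] at hzA ⊢
    intro l _
    rcases eq_or_ne l i with rfl | hl
    · simpa using hs
    · simpa [Function.update_of_ne hl] using hzA l (mem_univ l)
  have hTA : ∀ F ∈ 𝓕, jointFunctional T F ∈ A := fun F hF => hT.subset (mem_image_of_mem _ hF)
  have hcoord : ∀ x ∈ A, ∀ i, x i ∈ Ai i := fun x hx i => (hA ▸ hx : x ∈ univ.pi Ai) i (mem_univ i)
  -- Since k·c = k - 1, this splits the surplus (k - 1) S(z,·) evenly among the `k` summands.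
  let c : ℝ := 1 - (k : ℝ)⁻¹
  have hkc : (k : ℝ) * c = k - 1 := by
    have : (k : ℝ) ≠ 0 := by positivity
    simp only [c]
    field_simp
  let Si : Fin k → ℝ → O → ℝ := fun i s y => S (Function.update z i s) y - c * S z y
  have hSi_int : ∀ i, ClassIntegrable 𝓕 (Ai i) (Si i) := by
    intro i s hs
    obtain ⟨hm1, hi1⟩ := hS.integrable _ (hupd i s hs)
    obtain ⟨hm2, hi2⟩ := hS.integrable _ hzA
    exact ⟨hm1.sub (hm2.const_mul c), fun F hF => (hi1 F hF).sub ((hi2 F hF).const_mul c)⟩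
  have hSi_mean : ∀ i, ∀ s ∈ Ai i, ∀ F ∈ 𝓕,
      mean (Si i) s F = mean S (Function.update z i s) F - c * mean S z F := by
    intro i s hs F hF
    simp only [mean, Si]
    rw [integral_sub ((hS.integrable _ (hupd i s hs)).2 F hF)
      (((hS.integrable _ hzA).2 F hF).const_mul c), integral_const_mul]
  have hsum : ∀ x ∈ A, ∀ F ∈ 𝓕, mean S x F = ∑ i, mean (Si i) (x i) F := by
    intro x hx F hF
    have h1 := mean_score_separable hconv hA hAc hArect hT hV hV4 hS2 hS hF hz hx
    rw [Finset.sum_congr rfl fun i _ => hSi_mean i (x i) (hcoord x hx i) F hF,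
      Finset.sum_sub_distrib]
    simp only [Finset.sum_const, Finset.card_univ, Fintype.card_fin, nsmul_eq_mul] at h1 ⊢
    rw [← mul_assoc, hkc]
    linarith
  -- Moving only the i-th coordinate away from `T(F)` isolates the i-th summand, so consistency and
  -- strictness pass from `S` to `Si i`.
  have hdiff : ∀ i, ∀ s ∈ Ai i, ∀ F ∈ 𝓕, Function.update (jointFunctional T F) i s ∈ A ∧
      mean S (Function.update (jointFunctional T F) i s) F - mean S (jointFunctional T F) F
        = mean (Si i) s F - mean (Si i) (T i F) F := by
    intro i s hs F hF
    have hmem : Function.update (jointFunctional T F) i s ∈ A := by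
      have := hTA F hF
      rw [hA] at this ⊢
      intro l _
      rcases eq_or_ne l i with rfl | hl
      · simpa using hs
      · simpa [Function.update_of_ne hl] using this l (mem_univ l)
    refine ⟨hmem, ?_⟩
    rw [hsum _ hmem F hF, hsum _ (hTA F hF) F hF, ← Finset.sum_sub_distrib,
      Finset.sum_eq_single i]
    · simp [jointFunctional]
    · intro l _ hl
      simp [Function.update_of_ne hl]
    · simp
  refine ⟨Si, fun i => ⟨hSi_int i, fun s hs F hF => ?_, fun s hs F hF heq => ?_⟩, ?_, ?_⟩
  · obtain ⟨hmem, h⟩ := hdiff i s hs F hF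
    have := hS.consistent _ hmem F hF
    linarith
  · obtain ⟨hmem, h⟩ := hdiff i s hs F hF
    have := congrFun (hS.strict _ hmem F hF (by linarith)) i
    simpa [jointFunctional] using this
  · have hae : ∀ᵐ p : (Fin k → ℝ) × (Fin d → ℝ),
        p ∉ {p : (Fin k → ℝ) × (Fin d → ℝ) | p.1 ∈ univ.pi Ai ∧
          ∃ h : p.2 ∈ O, ¬ S p.1 ⟨p.2, h⟩ = ∑ i, Si i (p.1 i) ⟨p.2, h⟩} := by
      filter_upwards [hgen, measure_eq_zero_iff_ae_notMem.1 hVS1] with p hp hpx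
      rintro ⟨hpA, hpO, hneq⟩
      rw [← hA] at hpA
      -- By genericity of `z`, S(x,·), S(z,·) and all the S(z with i-th entry x_i, ·) are continuous
      -- at `y`, so both sides of the expected-score identity converge along measures tending to
      -- δ_y.
      obtain ⟨F, hF, hlim, K, hK, hFK⟩ := hF1 ⟨p.2, hpO⟩
      have := fun n => hprob (F n) (hF n)
      have hconvg : ∀ x ∈ A, (x, p.2) ∉ {p : (Fin k → ℝ) × (Fin d → ℝ) | p.1 ∈ A ∧
          ∃ h : p.2 ∈ O, ¬ ((∀ i, ContinuousAt (V i (p.1 i)) ⟨p.2, h⟩) ∧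
            ContinuousAt (S p.1) ⟨p.2, h⟩)} →
          Tendsto (fun n => mean S x (F n)) atTop (𝓝 (S x ⟨p.2, hpO⟩)) := by
        intro x hx hxN
        obtain ⟨M, hM⟩ := hSbdd x hx K hK
        have hc : ContinuousAt (S x) ⟨p.2, hpO⟩ := by
          by_contra hc
          exact hxN ⟨hx, hpO, fun h => hc h.2⟩
        exact tendsto_integral_of_tendsto_dirac hlim hFK hM
          (fun n => (hS.integrable x hx).2 (F n) (hF n)) hc
      have h1 := hconvg p.1 hpA hpx
      have h2 : Tendsto (fun n => mean S p.1 (F n)) atTop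
          (𝓝 (∑ i, Si i (p.1 i) ⟨p.2, hpO⟩)) := by
        refine (tendsto_finsetSum Finset.univ fun i _ =>
          (hconvg _ (hupd i (p.1 i) (hcoord _ hpA i)) (hp.2 i)).sub
            ((hconvg z hzA hp.1).const_mul c)).congr fun n => ?_
        rw [hsum p.1 hpA (F n) (hF n)]
        exact Finset.sum_congr rfl fun i _ =>
          (hSi_mean i (p.1 i) (hcoord _ hpA i) (F n) (hF n)).symm
      exact hneq (tendsto_nhds_unique h1 h2)
    exact measure_eq_zero_iff_ae_notMem.2 hae
  · rw [← hA]
    exact hsum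

/-- Every summand is minimal at T_i(F), so equality of the sums forces equality in each term, and
strictness then applies coordinatewise. -/
theorem strictlyConsistent_of_mean_eq_sum (hA : A = Set.univ.pi Ai)
    (hT : jointFunctional T '' 𝓕 = A) (hS : ClassIntegrable 𝓕 A S) {Si : Fin k → ℝ → O → ℝ}
    (hSi : ∀ i, StrictlyConsistent 𝓕 (Ai i) (T i) (Si i))
    (hsum : ∀ x ∈ A, ∀ F ∈ 𝓕, mean S x F = ∑ i, mean (Si i) (x i) F) :
    StrictlyConsistent 𝓕 A (jointFunctional T) S := by
  have hcoord : ∀ x ∈ A, ∀ i, x i ∈ Ai i := fun x hx i => (hA ▸ hx : x ∈ univ.pi Ai) i (mem_univ i)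
  have hTA : ∀ F ∈ 𝓕, jointFunctional T F ∈ A := fun F hF => hT.subset (mem_image_of_mem _ hF)
  refine ⟨hS, fun x hx F hF => ?_, fun x hx F hF heq => ?_⟩
  · rw [hsum x hx F hF, hsum _ (hTA F hF) F hF]
    exact Finset.sum_le_sum fun i _ => (hSi i).consistent (x i) (hcoord x hx i) F hF
  · rw [hsum x hx F hF, hsum _ (hTA F hF) F hF, eq_comm] at heq
    replace heq := (Finset.sum_eq_sum_iff_of_le fun i _ =>
      (hSi i).consistent (x i) (hcoord x hx i) F hF).1 heq
    funext i
    exact (hSi i).strict (x i) (hcoord x hx i) F hF (heq i (Finset.mem_univ i)).symm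

theorem strictlyConsistent_sum (hA : A = Set.univ.pi Ai) (hT : jointFunctional T '' 𝓕 = A)
    {Si : Fin k → ℝ → O → ℝ} (hSi : ∀ i, StrictlyConsistent 𝓕 (Ai i) (T i) (Si i)) :
    StrictlyConsistent 𝓕 A (jointFunctional T) (fun x y => ∑ i, Si i (x i) y) := by
  have hint : ∀ x ∈ A, ∀ i, Measurable (Si i (x i)) ∧ ∀ F ∈ 𝓕, Integrable (Si i (x i)) F :=
    fun x hx i => (hSi i).integrable (x i) ((hA ▸ hx : x ∈ univ.pi Ai) i (mem_univ i))
  refine strictlyConsistent_of_mean_eq_sum hA hT (fun x hx => ⟨?_, fun F hF => ?_⟩) hSi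
    fun x hx F hF => ?_
  · exact Finset.measurable_fun_sum _ fun i _ => (hint x hx i).1
  · exact integrable_finsetSum _ fun i _ => (hint x hx i).2 F hF
  · exact integral_finsetSum _ fun i _ => (hint x hx i).2 F hF

end Vector

end Elicitability

theorem mainTheorem8 {k d : ℕ} (hk : 1 < k) (O : Set (Fin d → ℝ))
    -- a convex class of Borel probability measures on `O`
    (𝓕 : Set (Measure O)) (hprob : ∀ F ∈ 𝓕, IsProbabilityMeasure F) (hconv : Convex ℝ≥0 𝓕)
    -- the action domain `A = A₁ × ⋯ × A_k`
    (Ai : Fin k → Set ℝ) (A : Set (Fin k → ℝ)) (hA : A = Set.univ.pi Ai)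
    (hAconn : IsConnected A) (hArect : IsOpenHyperrectangle (interior A))
    -- the functional `T = (T₁, …, T_k)` is surjective onto `A`
    (T : Fin k → Measure O → ℝ) (hT : jointFunctional T '' 𝓕 = A)
    (hF1 : AssumptionF1 𝓕)
    -- the scoring function
    (S : (Fin k → ℝ) → O → ℝ) (hS : ClassIntegrable 𝓕 A S) (hS2 : AssumptionS2 𝓕 A T S)
    (hSbdd : ScoreLocallyBounded A S) :
    -- characterization of the strictly consistent scoring functions
    (∀ V : Fin k → ℝ → O → ℝ,
      (∀ i, OrientedStrictIdentification 𝓕 (Ai i) (T i) (V i)) →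
      AssumptionV1 𝓕 A V → AssumptionV4 𝓕 A T V → AssumptionVS1 A V S → AssumptionB1 A V →
      (StrictlyConsistent 𝓕 A (jointFunctional T) S ↔ Separable 𝓕 Ai T S)) ∧
    -- every sum of strictly consistent scoring functions is strictly consistent
    (∀ Si : Fin k → ℝ → O → ℝ,
      (∀ i, StrictlyConsistent 𝓕 (Ai i) (T i) (Si i)) →
      StrictlyConsistent 𝓕 A (jointFunctional T) (fun x y => ∑ i, Si i (x i) y)) ∧
    -- application to vectors of quantiles
    (∀ (j : Fin k → Fin d) (α : Fin k → ℝ), (∀ i, α i ∈ Set.Ioo (0 : ℝ) 1) →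
      (∀ F ∈ 𝓕, ∀ i, Continuous (coordCDF F (j i)) ∧
        lowerQuantile (coordCDF F (j i)) (α i) = upperQuantile (coordCDF F (j i)) (α i) ∧
        T i F = lowerQuantile (coordCDF F (j i)) (α i)) →
      AssumptionV1 𝓕 A (quantileV j α) → AssumptionV4 𝓕 A T (quantileV j α) →
      AssumptionVS1 A (quantileV j α) S →
      (StrictlyConsistent 𝓕 A (jointFunctional T) S ↔ Separable 𝓕 Ai T S)) ∧
    -- application to vectors of expectiles
    (∀ (j : Fin k → Fin d) (τ : Fin k → ℝ), (∀ i, τ i ∈ Set.Ioo (0 : ℝ) 1) →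
      (∀ F ∈ 𝓕, ∀ i, IsExpectile F (j i) (τ i) (T i F)) →
      AssumptionV1 𝓕 A (expectileV j τ) → AssumptionV4 𝓕 A T (expectileV j τ) →
      AssumptionVS1 A (expectileV j τ) S →
      (StrictlyConsistent 𝓕 A (jointFunctional T) S ↔ Separable 𝓕 Ai T S)) := by
  have main : ∀ V : Fin k → ℝ → O → ℝ,
      (∀ i, OrientedStrictIdentification 𝓕 (Ai i) (T i) (V i)) →
      AssumptionV4 𝓕 A T V → AssumptionVS1 A V S →
      (StrictlyConsistent 𝓕 A (jointFunctional T) S ↔ Separable 𝓕 Ai T S) := by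
    intro V hV hV4 hVS1
    refine ⟨separable_of_strictlyConsistent hk hprob hconv hA hAconn hArect hT hF1 hS2 hSbdd hV
      hV4 hVS1, ?_⟩
    rintro ⟨Si, hSi, -, hsum⟩
    rw [← hA] at hsum
    exact strictlyConsistent_of_mean_eq_sum hA hT hS hSi hsum
  refine ⟨fun V hV _ hV4 hVS1 _ => main V hV hV4 hVS1,
    fun Si hSi => strictlyConsistent_sum hA hT hSi, fun j α hα hTq _ hV4 hVS1 => ?_,
    fun j τ hτ hTe _ hV4 hVS1 => ?_⟩
  · exact main _ (fun i => quantileV_identification hprob (hα i) (fun F hF => hTq F hF i) (Ai i))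
      hV4 hVS1
  · exact main _ (fun i => expectileV_identification hprob (hτ i) (fun F hF => hTe F hF i) (Ai i))
      hV4 hVS1
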